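/- Let $q$ be a prime power, $K=\mathbb F_q(X)$, and let $G=\mathbb Z/r_1\mathbb Z\times\dots\times\mathbb Z/r_n\mathbb Z$ with $r_j\mid r_{j+1}$ and $q\equiv 1 \pmod{r_j}$ for all $j$ (equivalently $q\equiv 1\pmod{\exp(G)}$). Let $\mathcal R$ be the set of integer vectors $\vec\alpha=(\alpha_1,\dots,\alpha_n)\neq\vec 0$ with $0\le\alpha_j\le r_j-1$, and let $d(\vec\alpha)\ge 0$ $(\vec\alpha\in\mathcal R)$ be integers with $\sum_{\vec\alpha\in\mathcal R}\alpha_j d(\vec\alpha)\equiv 0\pmod{r_j}$ for all $j$. Let $\vec c=(c_1,\dots,c_n)\in(\mathbb F_q^*)^n$, and let $(f_{\vec\alpha})_{\vec\alpha\in\mathcal R}$ be monic, squarefree, pairwise coprime polynomials in $\mathbb F_q[X]$ such that either $\deg f_{\vec\alpha}=d(\vec\alpha)$ for all $\vec\alpha$, or, for some $\vec\beta\in\mathcal R$, $\deg f_{\vec\beta}=d(\vec\beta)-1$ and $\deg f_{\vec\alpha}=d(\vec\alpha)$ for all $\vec\alpha\ne\vec\beta$. Put $F_j=c_j\prod_{\vec\alpha\in\mathcal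 R}f_{\vec\alpha}^{\alpha_j}$. Let $C$ be the smooth projective curve over $\mathbb F_q$ corresponding to $(\vec c,(f_{\vec\alpha}))$, that is, with function field $K(C)=K(\sqrt[r_1]{F_1},\dots,\sqrt[r_n]{F_n})$, and suppose that $K(C)/K$ is Galois with $\mathrm{Gal}(K(C)/K)\cong G$. Let $\#C(\mathbb P^1(\mathbb F_q))$ denote the number of $\mathbb F_q$-rational points of $C$, i.e. of primes of $K(C)$ whose residue field is $\mathbb F_q$. Let $\mathcal S$ be the set of vectors $\vec s=(s_1,\dots,s_n)$ of positive integers with $s_j\mid r_j$, let $\ell(\vec s)=\mathrm{lcm}(s_1,\dots,s_n)$, and let $\Omega_{\vec s}$ be the set of integer vectors $\vec\omega$ with $1\le\omega_j\le s_j$ and $(\omega_j,s_j)=1$. For $\vec s\in\mathcal S$, $\vec\omega\in\Omega_{\vec s}$ put $$c_{(\vec s)}^{(\vec\omega)}=\prod_{j=1}^n c_j^{\frac{\ell(\vec s)}{s_j}\omega_j \bmod \ell(\vec s)},\qquad F_{(\vec s)}^{(\vec\omega)}(X)=c_{(\vec s)}^{(\vec\omega)}\prod_{\vec\alpha\in\mathcal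 R}f_{\vec\alpha}(X)^{\sum_{j=1}^n\frac{\ell(\vec s)}{s_j}\omega_j\alpha_j \bmod \ell(\vec s)},$$ where $*\bmod \ell(\vec s)$ in an exponent is the smallest non-negative residue and $f^0=1$. At the point $\infty$ of $\mathbb P^1(\mathbb F_q)$ put $F_{(\vec s)}^{(\vec\omega)}(\infty)=c_{(\vec s)}^{(\vec\omega)}$ if $\sum_{j=1}^n\frac{\ell(\vec s)}{s_j}\omega_j\deg F_j\equiv 0\pmod{\ell(\vec s)}$, and $F_{(\vec s)}^{(\vec\omega)}(\infty)=0$ otherwise. For each $m$ dividing $\exp(G)$ let $\chi_m:\mathbb F_q^*\to\mathbb C^*$ be a multiplicative character of order $m$, extended by $\chi_m(0)=0$. Then $$\#C(\mathbb P^1(\mathbb F_q))=\sum_{x\in\mathbb P^1(\mathbb F_q)}\ \sum_{\vec s\in\mathcal S}\ \sum_{\vec\omega\in\Omega_{\vec s}}\chi_{\ell(\vec s)}\bigl(F_{(\vec s)}^{(\vec\omega)}(x)\bigr).$$ -/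

import Mathlib

open Polynomial

namespace AbelianCover

/-! ### Points of the smooth projective curve with a given function field

The smooth projective curve `C` over `k` with function field `L` is the set of all discrete
valuation rings of `L` that contain `k` (the abstract nonsingular curve of `L / k`, whose points are
the primes of `L`).  A point of `C` is `k`-rational when its residue field is `k`. -/

/-- `V` is a (closed) point of the smooth projective curve over `k` with function field `L`:
a discrete valuation ring of `L` (its fraction field is `L`) that contains the constants `k`. -/
structure IsCurvePoint (k : Type*) {L : Type*} [Field k] [Field L] [Algebra k L]
    (V : ValuationSubring L) : Prop where
  const_mem : ∀ a : k, algebraMap k L a ∈ V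
  dvr : IsDiscreteValuationRing V

/-- The map `k → V / 𝔪_V` from the constants to the residue field at a point. -/
noncomputable def IsCurvePoint.toResidueField {k L : Type*} [Field k] [Field L] [Algebra k L]
    {V : ValuationSubring L} (h : IsCurvePoint k V) : k →+* IsLocalRing.ResidueField V :=
  (IsLocalRing.residue V).comp ((algebraMap k L).codRestrict V.toSubring h.const_mem)

/-- The set `C(k)` of `k`-rational points of the smooth projective curve `C` over `k` with function
field `L`: the points whose residue field is `k` (the primes of degree one). -/
def rationalPoints (k L : Type*) [Field k] [Field L] [Algebra k L] : Set (ValuationSubring L) :=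
  {V | ∃ h : IsCurvePoint k V, Function.Bijective h.toResidueField}

/-! ### Tuples of polynomials -/

/-- The index set `𝓡`: integer vectors `α` with `0 ≤ α_j ≤ r_j - 1`, not all entries zero. -/
abbrev IndexSet {n : ℕ} (r : Fin n → ℕ) : Type :=
  {α : (j : Fin n) → Fin (r j) // ∃ j, (α j : ℕ) ≠ 0}

section Tuples

variable {F : Type*} [Field F] {n : ℕ} {r : Fin n → ℕ}

/-- Tuples of monic, squarefree, pairwise coprime polynomials. -/
def IsAdmissibleTuple (f : IndexSet r → F[X]) : Prop :=
  (∀ α, (f α).Monic ∧ Squarefree (f α)) ∧ ∀ α β, α ≠ β → IsCoprime (f α) (f β)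

/-- `𝓕_d`: the admissible tuples with `deg f_α = d(α)` for all `α`. -/
def tuples (F : Type*) [Field F] {n : ℕ} {r : Fin n → ℕ} (d : IndexSet r → ℕ) :
    Set (IndexSet r → F[X]) :=
  {f | IsAdmissibleTuple f ∧ ∀ α, (f α).natDegree = d α}

/-- `𝓕_d^β`: the admissible tuples with `deg f_β = d(β) - 1` (an equation of integers, so that
there are none if `d(β) = 0`) and `deg f_α = d(α)` for all `α ≠ β`. -/
def tuplesDrop (F : Type*) [Field F] {n : ℕ} {r : Fin n → ℕ} (d : IndexSet r → ℕ)
    (β : IndexSet r) : Set (IndexSet r → F[X]) :=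
  {f | IsAdmissibleTuple f ∧ (f β).natDegree + 1 = d β ∧ ∀ α, α ≠ β → (f α).natDegree = d α}

/-- `𝓕_[d]`, the union of `𝓕_d` and of all `𝓕_d^β`. -/
def tuplesBracket (F : Type*) [Field F] {n : ℕ} {r : Fin n → ℕ} (d : IndexSet r → ℕ) :
    Set (IndexSet r → F[X]) :=
  tuples F d ∪ ⋃ β, tuplesDrop F d β

/-- The Kummer generator `F_j = c_j ∏_α f_α ^ α_j`. -/
noncomputable def kummerPoly (c : Fin n → Fˣ) (f : IndexSet r → F[X]) (j : Fin n) : F[X] :=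
  C (c j : F) * ∏ α : IndexSet r, f α ^ (α.1 j : ℕ)

/-- The curve with function field `L` over `K = F(X)` is Galois over the line with group
`G = ∏ ℤ/r_j` and corresponds to `(c, (f_α))`:
`Gal(L/K) ≅ G` and `L = K(F_1 ^ (1/r_1), …, F_n ^ (1/r_n))`. -/
structure CorrespondsTo (L : Type*) [Field L] [Algebra (RatFunc F) L]
    (c : Fin n → Fˣ) (f : IndexSet r → F[X]) : Prop where
  isGalois : IsGalois (RatFunc F) L
  galEquiv : Nonempty ((L ≃ₐ[RatFunc F] L) ≃* Multiplicative ((j : Fin n) → ZMod (r j)))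
  generators : ∃ y : Fin n → L,
    (∀ j, y j ^ r j = algebraMap (RatFunc F) L (algebraMap F[X] (RatFunc F) (kummerPoly c f j))) ∧
    IntermediateField.adjoin (RatFunc F) (Set.range y) = ⊤

end Tuples

/-! ### The polynomials `F_(s)^(ω)` and their values on the projective line -/

/-- `𝓢`: the vectors `s` of positive integers with `s_j ∣ r_j`. -/
def divisorVectors {n : ℕ} (r : Fin n → ℕ) : Finset (Fin n → ℕ) :=
  Fintype.piFinset fun j => (r j).divisors

/-- `ℓ(s) = lcm(s_1, …, s_n)`. -/
def ell {n : ℕ} (s : Fin n → ℕ) : ℕ := Finset.univ.lcm s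

/-- `Ω_s`: the vectors `ω` with `1 ≤ ω_j ≤ s_j` and `(ω_j, s_j) = 1`. -/
def Omega {n : ℕ} (s : Fin n → ℕ) : Finset (Fin n → ℕ) :=
  Fintype.piFinset fun j => (Finset.Icc 1 (s j)).filter fun w => Nat.Coprime w (s j)

section Values

variable {F : Type*} [Field F] {n : ℕ} {r : Fin n → ℕ}

/-- `c_(s)^(ω) = ∏_j c_j ^ ((ℓ(s)/s_j) ω_j mod ℓ(s))`. -/
def leadCoeff (c : Fin n → Fˣ) (s ω : Fin n → ℕ) : F :=
  ∏ j, (c j : F) ^ ((ell s / s j * ω j) % ell s)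

/-- `F_(s)^(ω) = c_(s)^(ω) ∏_α f_α ^ (∑_j (ℓ(s)/s_j) ω_j α_j mod ℓ(s))`. -/
noncomputable def twistedPoly (c : Fin n → Fˣ) (f : IndexSet r → F[X]) (s ω : Fin n → ℕ) : F[X] :=
  C (leadCoeff c s ω) *
    ∏ α : IndexSet r, f α ^ ((∑ j, ell s / s j * ω j * (α.1 j : ℕ)) % ell s)

/-- The value `F_(s)^(ω)(x)` for `x` in the projective line `F ∪ {∞}`.  At a finite point it is the
value of the polynomial.  At infinity, with `d_j = deg F_j`, it is `c_(s)^(ω)` if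
`∑_j (ℓ(s)/s_j) ω_j d_j ≡ 0 mod ℓ(s)`, and `0` otherwise. -/
noncomputable def twistedValue (c : Fin n → Fˣ) (f : IndexSet r → F[X]) (s ω : Fin n → ℕ) :
    OnePoint F → F
  | OnePoint.some x => (twistedPoly c f s ω).eval x
  | OnePoint.infty =>
      if ell s ∣ ∑ j, ell s / s j * ω j * (kummerPoly c f j).natDegree then leadCoeff c s ω else 0

end Values

end AbelianCover

/-!
Let `y_j ^ r_j = F_j` generate `K(C)` and let `N` be the exponent of `G`. Fix `x ∈ ℙ¹(𝔽_q)` and a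
uniformizer `t` at `x`, and write `F_j = t ^ k_j g_j` with `g_j(x) ≠ 0`. The exponent vectors `e`
for which `∏ y_j ^ e_j` has integral order above `x` are the kernel `H` of the homomorphism
`e ↦ ∑ (N / r_j) e_j k_j` from `∏ ℤ/r_j` to `ℤ/N`; dividing such a monomial by a power of `t` gives
a unit above `x`, whose `N`-th power has a known residue in `𝔽_q`. A point above `x` with residue
field `𝔽_q` forces these residues to be `N`-th powers. Conversely, if they are, then the Galois
translates of a point above `x` are separated by the characters of `H`, so there are at least
`|H|` of them, while the ramification index is at least `|G| / |H|`; by `∑ e f = |G|` both bounds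
are sharp and all residue degrees are `1`. Orthogonality of characters on `H` turns the count, `|H|`
or `0`, into a character sum over the exponent vectors. These are reindexed by the pairs `(s, ω)`
through `e_j = u ω_j r_j / s_j`, where the unit `u` depends on `s` and accounts for `χ_ℓ(s)` being a
power of `χ_N` only up to a unit exponent.
-/

namespace AbelianCover

section ExponentVectors

variable {ι : Type*} {r : ι → ℕ}

theorem natCast_val_eq [∀ j, NeZero (r j)] (e : ∀ j, ZMod (r j)) :
    (fun j => (((e j).val : ℕ) : ZMod (r j))) = e :=
  funext fun j => ZMod.natCast_zmod_val (e j)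

variable [Fintype ι] {M : Type*} [AddCommGroup M]

/-- The homomorphism `∏ ℤ/r_j → M`, `e ↦ ∑ e_j a_j`, for elements `a_j` killed by `r_j`. -/
noncomputable def zmodPiLift (a : ι → M) (ha : ∀ j, r j • a j = 0) : (∀ j, ZMod (r j)) →+ M :=
  ∑ j, (ZMod.lift (r j) ⟨zmultiplesHom M (a j), by simpa using ha j⟩).comp
    (Pi.evalAddMonoidHom _ j)

theorem zmodPiLift_natCast (a : ι → M) (ha : ∀ j, r j • a j = 0) (m : ι → ℕ) :
    zmodPiLift a ha (fun j => (m j : ZMod (r j))) = ∑ j, m j • a j := by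
  simp only [zmodPiLift, AddMonoidHom.finsetSum_apply, AddMonoidHom.comp_apply,
    Pi.evalAddMonoidHom_apply]
  refine Finset.sum_congr rfl fun j _ => ?_
  simpa using ZMod.lift_coe (r j) ⟨zmultiplesHom M (a j), by simpa using ha j⟩ (m j : ℤ)

theorem sum_val_nsmul_single [DecidableEq ι] [∀ j, NeZero (r j)] (e : ∀ j, ZMod (r j)) :
    ∑ j, (e j).val • Pi.single j (1 : ZMod (r j)) = e := by
  simp only [← Pi.single_smul, nsmul_eq_mul, mul_one, ZMod.natCast_zmod_val,
    Finset.univ_sum_single]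

variable {N : ℕ}

/-- If `y_j` has order `k_j / r_j` at a place, this sends the exponent vector `e` to `N` times the
order of `∏ y_j ^ e_j`, modulo `N`; its kernel consists of the monomials of integral order. -/
noncomputable def orderHom (hr : ∀ j, r j ∣ N) (k : ι → ℤ) : (∀ j, ZMod (r j)) →+ ZMod N :=
  zmodPiLift (fun j => ((N / r j : ℕ) : ZMod N) * (k j : ZMod N)) fun j => by
    rw [nsmul_eq_mul, ← mul_assoc, ← Nat.cast_mul, Nat.mul_div_cancel' (hr j), ZMod.natCast_self,
      zero_mul]

theorem orderHom_natCast (hr : ∀ j, r j ∣ N) (k : ι → ℤ) (m : ι → ℕ) :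
    orderHom hr k (fun j => (m j : ZMod (r j))) =
      ((∑ j, ((N / r j * m j : ℕ) : ℤ) * k j : ℤ) : ZMod N) := by
  rw [orderHom, zmodPiLift_natCast, Int.cast_sum]
  refine Finset.sum_congr rfl fun j _ => ?_
  rw [nsmul_eq_mul, Int.cast_mul, Int.cast_natCast, Nat.cast_mul]
  ring

theorem orderHom_apply [∀ j, NeZero (r j)] (hr : ∀ j, r j ∣ N) (k : ι → ℤ)
    (e : ∀ j, ZMod (r j)) :
    orderHom hr k e = ((∑ j, ((N / r j * (e j).val : ℕ) : ℤ) * k j : ℤ) : ZMod N) := by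
  rw [← orderHom_natCast hr, natCast_val_eq]

theorem mem_ker_orderHom [∀ j, NeZero (r j)] {hr : ∀ j, r j ∣ N} {k : ι → ℤ}
    {e : ∀ j, ZMod (r j)} :
    e ∈ (orderHom hr k).ker ↔ (N : ℤ) ∣ ∑ j, ((N / r j * (e j).val : ℕ) : ℤ) * k j := by
  rw [AddMonoidHom.mem_ker, orderHom_apply, ZMod.intCast_zmod_eq_zero_iff_dvd]

/-- The condition under which a place with residue field `F` lies below points with residue field
`F`: every monomial of integral order, divided by the corresponding power of a uniformizer, has as
`N`-th power a unit whose residue is an `N`-th power.  Here `b_j` is the residue of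
`y_j ^ r_j / ϖ ^ k_j`. -/
def HasPowerResidues {F : Type*} [Field F] (hr : ∀ j, r j ∣ N) (k : ι → ℤ) (b : ι → Fˣ) : Prop :=
  ∀ e ∈ (orderHom hr k).ker, ∃ w : Fˣ, w ^ N = ∏ j, b j ^ (N / r j * (e j).val)

end ExponentVectors

section Kummer

variable {F : Type*} [Field F] {N : ℕ} [NeZero N] [HasEnoughRootsOfUnity F N]

theorem exists_eq_rootsOfUnity_mul {R : Type*} [CommRing R] [IsDomain R] [Algebra F R] {x z : R}
    (h : z ^ N = x ^ N) : ∃ ζ ∈ rootsOfUnity N F, z = algebraMap F R (ζ : F) * x := by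
  obtain ⟨ξ, hξ⟩ := HasEnoughRootsOfUnity.exists_primitiveRoot F N
  have hξR : IsPrimitiveRoot (algebraMap F R ξ) N :=
    hξ.map_of_injective (algebraMap F R).injective
  have hprod := hξR.pow_sub_pow_eq_prod_sub_mul z x (NeZero.pos N)
  rw [h, sub_self, eq_comm, Finset.prod_eq_zero_iff] at hprod
  obtain ⟨ζ, hζ, hz⟩ := hprod
  obtain ⟨i, -, rfl⟩ := hξR.eq_pow_of_pow_eq_one ((mem_nthRootsFinset (NeZero.pos N) _).1 hζ)
  refine ⟨(hξ.isUnit (NeZero.ne N)).unit ^ i, ?_, ?_⟩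
  · rw [mem_rootsOfUnity', Units.val_pow_eq_pow_val, IsUnit.unit_spec, pow_right_comm,
      hξ.pow_eq_one, one_pow]
  · rw [Units.val_pow_eq_pow_val, IsUnit.unit_spec, map_pow, sub_eq_zero.1 hz]

variable {K L ι : Type*} [Field K] [Field L] [Algebra K L] [Algebra F L] [Fintype ι] {r : ι → ℕ}
  {y : ι → L}

/-- `L = K(y_1, …, y_n)` where `y_j` is an `r_j`-th root of an element of `K`, and the degree
`[L : K]` is as large as possible. -/
structure IsFullKummer (K : Type*) {L ι : Type*} [Field K] [Field L] [Algebra K L] [Fintype ι]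
    (r : ι → ℕ) (y : ι → L) : Prop where
  pow_mem_range : ∀ j, y j ^ r j ∈ (algebraMap K L).range
  adjoin_eq_top : IntermediateField.adjoin K (Set.range y) = ⊤
  finrank_eq : Module.finrank K L = ∏ j, r j

/-- By cardinality, since an automorphism is determined by the roots of unity `σ(y_j) / y_j`. -/
theorem IsFullKummer.exists_algEquiv [FiniteDimensional K L] [IsGalois K L]
    (h : IsFullKummer K r y) (hr : ∀ j, r j ∣ N) (ζ : ∀ j, rootsOfUnity (r j) F) :
    ∃ σ : L ≃ₐ[K] L, ∀ j, σ (y j) = algebraMap F L ((ζ j : Fˣ) : F) * y j := by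
  have hr0 : ∀ j, NeZero (r j) := fun j => ⟨ne_zero_of_dvd_ne_zero (NeZero.ne N) (hr j)⟩
  have hroots : ∀ j, HasEnoughRootsOfUnity F (r j) := fun j => .of_dvd F (hr j)
  have hquot : ∀ (σ : L ≃ₐ[K] L) (j : ι), ∃ z : rootsOfUnity (r j) F,
      σ (y j) = algebraMap F L ((z : Fˣ) : F) * y j := by
    intro σ j
    obtain ⟨a, ha⟩ := h.pow_mem_range j
    obtain ⟨z, hz, hσ⟩ := exists_eq_rootsOfUnity_mul (F := F) (N := r j) (x := y j) (z := σ (y j))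
      (by rw [← map_pow, ← ha, AlgEquiv.commutes])
    exact ⟨⟨z, hz⟩, hσ⟩
  choose z hz using hquot
  have hinj : Function.Injective z := fun σ τ hστ => by
    have hgen := IntermediateField.adjoin_eq_top_iff.1 h.adjoin_eq_top
    refine AlgEquiv.coe_toAlgHom_injective (AlgHom.ext_of_adjoin_eq_top hgen ?_)
    rintro _ ⟨j, rfl⟩
    simp only [AlgEquiv.coe_toAlgHom, hz, hστ]
  have hcard : Nat.card (L ≃ₐ[K] L) = Nat.card (∀ j, rootsOfUnity (r j) F) := by
    rw [IsGalois.card_aut_eq_finrank, h.finrank_eq, Nat.card_pi]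
    simp only [HasEnoughRootsOfUnity.natCard_rootsOfUnity]
  obtain ⟨σ, rfl⟩ := ((Nat.bijective_iff_injective_and_card z).2 ⟨hinj, hcard⟩).2 ζ
  exact ⟨σ, hz σ⟩

omit [NeZero N] [Fintype ι] in
theorem exponent_multiplicative_pi_zmod_dvd (hr : ∀ j, r j ∣ N) :
    Monoid.exponent (Multiplicative (∀ j, ZMod (r j))) ∣ N := by
  rw [Monoid.exponent_dvd_iff_forall_pow_eq_one]
  refine fun e => Multiplicative.toAdd.injective (funext fun j => ?_)
  rw [toAdd_pow, Pi.smul_apply, nsmul_eq_mul, (ZMod.natCast_eq_zero_iff _ _).2 (hr j), zero_mul,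
    toAdd_one, Pi.zero_apply]

theorem exists_rootsOfUnity_of_monoidHom (hr : ∀ j, r j ∣ N)
    {U : Subgroup (Multiplicative (∀ j, ZMod (r j)))} (φ : U →* Fˣ) :
    ∃ ζ : ∀ j, rootsOfUnity (r j) F, ∀ e : U,
      φ e = ∏ j, (ζ j : Fˣ) ^ (e.1.toAdd j).val := by
  classical
  have hr0 : ∀ j, NeZero (r j) := fun j => ⟨ne_zero_of_dvd_ne_zero (NeZero.ne N) (hr j)⟩
  have : Finite (Multiplicative (∀ j, ZMod (r j))) := inferInstanceAs (Finite (∀ j, ZMod (r j)))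
  have : HasEnoughRootsOfUnity F (Monoid.exponent (Multiplicative (∀ j, ZMod (r j)))) :=
    .of_dvd F (exponent_multiplicative_pi_zmod_dvd hr)
  obtain ⟨Φ, rfl⟩ := MonoidHom.domRestrict_surjective F U φ
  refine ⟨fun j => ⟨Φ (.ofAdd (Pi.single j 1)), ?_⟩, fun e => ?_⟩
  · rw [mem_rootsOfUnity, ← map_pow, ← ofAdd_nsmul, ← Pi.single_smul, nsmul_eq_mul,
      CharP.cast_eq_zero, zero_mul, Pi.single_zero, ofAdd_zero, map_one]
  · have he : e.1 = ∏ j, .ofAdd (Pi.single j (1 : ZMod (r j))) ^ (e.1.toAdd j).val := by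
      simp_rw [← ofAdd_nsmul]
      rw [← ofAdd_sum, sum_val_nsmul_single, ofAdd_toAdd]
    conv_lhs => rw [MonoidHom.domRestrictHom_apply, MonoidHom.domRestrict_apply, he, map_prod]
    simp only [map_pow]

theorem IsFullKummer.exists_algEquiv_of_monoidHom [FiniteDimensional K L] [IsGalois K L]
    (h : IsFullKummer K r y) (hr : ∀ j, r j ∣ N)
    {U : Subgroup (Multiplicative (∀ j, ZMod (r j)))} (φ : U →* Fˣ) :
    ∃ σ : L ≃ₐ[K] L, ∀ e : U, σ (∏ j, y j ^ (e.1.toAdd j).val) =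
      algebraMap F L (φ e) * ∏ j, y j ^ (e.1.toAdd j).val := by
  obtain ⟨ζ, hζ⟩ := exists_rootsOfUnity_of_monoidHom hr φ
  obtain ⟨σ, hσ⟩ := h.exists_algEquiv hr ζ
  refine ⟨σ, fun e => ?_⟩
  simp only [map_prod, map_pow, hσ, mul_pow, Finset.prod_mul_distrib, hζ, Units.coe_prod,
    Units.val_pow_eq_pow_val]

end Kummer

theorem natCard_le_of_forall_nsmul_eq_zero {G : Type*} [AddGroup G] [IsAddCyclic G] {m : ℕ}
    (hm : 0 < m) (h : ∀ x : G, m • x = 0) : Nat.card G ≤ m := by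
  rw [← IsAddCyclic.exponent_eq_card]
  exact Nat.le_of_dvd hm (AddMonoid.exponent_dvd_of_forall_nsmul_eq_zero h)

section PrimesOver

variable {A B : Type*} [CommRing A] [CommRing B] [Algebra A B]

/-- Equality is forced everywhere in `m u ≤ ∑ e_P f_P = [B : A]`. -/
theorem ncard_primesOver_eq_and_inertiaDeg_eq_one [IsDomain A] [Module.Finite A B]
    [Module.Flat A B] {p : Ideal A} [p.IsPrime] (hfin : (p.primesOver B).Finite) {u m : ℕ}
    (hm : 0 < m) (hrank : Module.finrank A B = u * m)
    (he : ∀ P ∈ p.primesOver B, m ≤ P.ramificationIdx A) (hu : u ≤ (p.primesOver B).ncard) :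
    (p.primesOver B).ncard = u ∧ ∀ P ∈ p.primesOver B, P.inertiaDeg A = 1 := by
  have := hfin.fintype
  have hsum := Ideal.sum_ramification_inertia_eq_finrank p B
  have hpos : ∀ q : p.primesOver B, 0 < q.1.inertiaDeg A := fun q =>
    have := q.2.1
    Ideal.inertiaDeg_pos _ _
  have hle : ∀ q ∈ (Finset.univ : Finset (p.primesOver B)),
      m ≤ q.1.ramificationIdx A * q.1.inertiaDeg A := fun q _ =>
    (he q q.2).trans (Nat.le_mul_of_pos_right _ (hpos q))
  have hconst : ∑ _q : p.primesOver B, m = (p.primesOver B).ncard * m := by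
    rw [Finset.sum_const, Finset.card_univ, ← Nat.card_eq_fintype_card, Nat.card_coe_set_eq,
      smul_eq_mul]
  have hncard : (p.primesOver B).ncard = u := by
    refine le_antisymm (Nat.le_of_mul_le_mul_right ?_ hm) hu
    rw [← hconst, ← hrank, ← hsum]
    exact Finset.sum_le_sum hle
  refine ⟨hncard, fun P hP => le_antisymm ?_ (hpos ⟨P, hP⟩)⟩
  have heq := (Finset.sum_eq_sum_iff_of_le hle).1
    (by rw [hconst, hsum, hrank, hncard]) ⟨P, hP⟩ (Finset.mem_univ _)
  refine Nat.le_of_mul_le_mul_left ?_ hm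
  calc m * P.inertiaDeg A ≤ P.ramificationIdx A * P.inertiaDeg A :=
        Nat.mul_le_mul_right _ (he P hP)
    _ = m * 1 := by rw [← heq, mul_one]

theorem surjective_algebraMap_quotient_of_inertiaDeg_eq_one {p : Ideal A} [p.IsMaximal]
    {P : Ideal B} [P.IsMaximal] [P.LiesOver p] (h : P.inertiaDeg A = 1) :
    Function.Surjective (algebraMap (A ⧸ p) (B ⧸ P)) := by
  let : Field (A ⧸ p) := Ideal.Quotient.field p
  rw [Ideal.inertiaDeg_eq_of_isMaximal p P] at h
  exact (Algebra.finrank_eq_one_iff_bijective_algebraMap.1 h).2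

theorem algebraMap_mem_of_liesOver_span_singleton {ϖ : A} (P : Ideal B)
    [P.LiesOver (Ideal.span {ϖ})] : algebraMap A B ϖ ∈ P :=
  (Ideal.mem_of_liesOver P (Ideal.span {ϖ}) ϖ).1 (Ideal.mem_span_singleton_self ϖ)

variable {F : Type*} [Field F] [Algebra F A] [Algebra F B] [IsScalarTower F A B]

/-- The primes of `B` above `p` with residue field `F`. -/
def rationalPrimesOver (F : Type*) {A : Type*} [Field F] [CommRing A] (p : Ideal A) (B : Type*)
    [CommRing B] [Algebra A B] [Algebra F B] : Set (Ideal B) :=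
  {P ∈ p.primesOver B | Function.Surjective (algebraMap F (B ⧸ P))}

/-- The residues of the `z h` at the translate of `P` by `σ φ` are `φ h * w h`, so the translates by
different characters differ. -/
theorem natCard_monoidHom_le_ncard_primesOver {H : Type*} [Monoid H] {p : Ideal A}
    (hfin : (p.primesOver B).Finite) {P : Ideal B} (hP : P ∈ p.primesOver B) {z : H → B}
    {w : H → Fˣ} (hz : ∀ h, z h - algebraMap F B (w h) ∈ P) {σ : (H →* Fˣ) → B ≃ₐ[A] B}
    (hσ : ∀ φ h, σ φ (z h) = algebraMap F B (φ h) * z h) :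
    Nat.card (H →* Fˣ) ≤ (p.primesOver B).ncard := by
  obtain ⟨hPprime, hPover⟩ := hP
  let Q : (H →* Fˣ) → p.primesOver B := fun φ => ⟨P.comap (σ φ), inferInstance, inferInstance⟩
  have hQ : ∀ φ h, z h - algebraMap F B (φ h * w h) ∈ (Q φ).1 := fun φ h => by
    change σ φ _ ∈ P
    rw [map_sub, hσ, IsScalarTower.algebraMap_apply F A B (_ * _), AlgEquiv.commutes,
      ← IsScalarTower.algebraMap_apply, map_mul, ← mul_sub]
    exact P.mul_mem_left _ (hz h)
  have hinj : Function.Injective Q := by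
    intro φ φ' hφ
    ext h
    have hmem := (Q φ).1.sub_mem (hφ ▸ hQ φ' h) (hQ φ h)
    rw [sub_sub_sub_cancel_left, ← map_sub] at hmem
    have hzero : (φ h : F) * w h - φ' h * w h = 0 := by
      by_contra hne
      exact (Q φ).2.1.ne_top (Ideal.eq_top_of_isUnit_mem _ hmem ((Ne.isUnit hne).map _))
    exact mul_right_cancel₀ (w h).ne_zero (sub_eq_zero.1 hzero)
  have := hfin.to_subtype
  rw [← Nat.card_coe_set_eq]
  exact Nat.card_le_card_of_injective Q hinj

end PrimesOver

section LocalKummer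

theorem prod_zpow_eq_zpow_sum {G ι : Type*} [CommGroupWithZero G] {x : G} (hx : x ≠ 0)
    (s : Finset ι) (a : ι → ℤ) : ∏ j ∈ s, x ^ a j = x ^ ∑ j ∈ s, a j := by
  induction s using Finset.cons_induction with
  | empty => simp
  | cons j s hj ih => rw [Finset.prod_cons, Finset.sum_cons, zpow_add₀ hx, ih]

/-- Local data of a Kummer extension at a place with uniformizer `ϖ`: the `r_j`-th power of the
generator `y_j` is `ϖ ^ k_j g_j`, where `g_j` is a unit at `ϖ` with residue `b_j`. -/
structure IsLocalKummer {F A L ι : Type*} [Field F] [CommRing A] [Field L] [Algebra F A]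
    [Algebra A L] (ϖ : A) (r : ι → ℕ) (k : ι → ℤ) (g : ι → A) (b : ι → Fˣ) (y : ι → L) :
    Prop where
  prime : Prime ϖ
  dvd_sub : ∀ j, ϖ ∣ g j - algebraMap F A (b j)
  root : ∀ j, y j ^ r j = algebraMap A L ϖ ^ k j * algebraMap A L (g j)

namespace IsLocalKummer

variable {F A L ι : Type*} [Field F] [CommRing A] [Field L] [Algebra F A] [Algebra A L]
  {ϖ : A} {r : ι → ℕ} {k : ι → ℤ} {g : ι → A} {b : ι → Fˣ} {y : ι → L} {N : ℕ}

theorem algebraMap_ne_zero [FaithfulSMul A L] (h : IsLocalKummer ϖ r k g b y) :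
    algebraMap A L ϖ ≠ 0 :=
  (FaithfulSMul.algebraMap_eq_zero_iff A L).not.2 h.prime.ne_zero

theorem isMaximal [IsDedekindDomain A] (h : IsLocalKummer ϖ r k g b y) :
    (Ideal.span {ϖ}).IsMaximal :=
  ((Ideal.span_singleton_prime h.prime.ne_zero).2 h.prime).isMaximal (by
    simpa using h.prime.ne_zero)

theorem root_pow (h : IsLocalKummer ϖ r k g b y) [NeZero N] {j : ι} (hr : r j ∣ N) (e : ℕ) :
    (y j ^ e) ^ N = algebraMap A L ϖ ^ (((N / r j * e : ℕ) : ℤ) * k j) *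
      algebraMap A L (g j ^ (N / r j * e)) := by
  calc (y j ^ e) ^ N = (y j ^ r j) ^ (N / r j * e) := by
        rw [← pow_mul, ← pow_mul, ← mul_assoc, Nat.mul_div_cancel' hr, mul_comm]
    _ = _ := by rw [h.root, mul_pow, ← zpow_natCast (_ ^ k j), ← zpow_mul, mul_comm (k j), map_pow]

variable [Fintype ι]

theorem monomial_pow [FaithfulSMul A L] [NeZero N] (h : IsLocalKummer ϖ r k g b y)
    (hr : ∀ j, r j ∣ N) (e : ι → ℕ) :
    (∏ j, y j ^ e j) ^ N = algebraMap A L ϖ ^ (∑ j, ((N / r j * e j : ℕ) : ℤ) * k j) *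
      algebraMap A L (∏ j, g j ^ (N / r j * e j)) := by
  rw [← Finset.prod_pow, Finset.prod_congr rfl fun j _ => h.root_pow (hr j) (e j),
    Finset.prod_mul_distrib, prod_zpow_eq_zpow_sum h.algebraMap_ne_zero, map_prod]

theorem algebraMap_prod_eq (h : IsLocalKummer ϖ r k g b y) {R : Type*} [CommRing R] [Algebra A R]
    [Algebra F R] [IsScalarTower F A R] (hϖ : algebraMap A R ϖ = 0) (c : ι → ℕ) :
    algebraMap A R (∏ j, g j ^ c j) = algebraMap F R (∏ j, b j ^ c j : Fˣ) := by
  have hg : ∀ j, algebraMap A R (g j) = algebraMap F R (b j) := fun j => by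
    rw [IsScalarTower.algebraMap_apply F A R, ← sub_eq_zero, ← map_sub]
    exact zero_dvd_iff.1 (hϖ ▸ map_dvd (algebraMap A R) (h.dvd_sub j))
  simp only [map_prod, map_pow, hg, Units.coe_prod, Units.val_pow_eq_pow_val]

variable {B : Type*} [CommRing B] [Algebra A B]

theorem exists_integral_monomial [Algebra B L] [IsScalarTower A B L] [IsIntegralClosure B A L]
    [FaithfulSMul A L] [NeZero N] (h : IsLocalKummer ϖ r k g b y) {hr : ∀ j, r j ∣ N}
    {e : ∀ j, ZMod (r j)} (he : e ∈ (orderHom hr k).ker) :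
    ∃ z : B, (∃ m : ℤ, algebraMap B L z = algebraMap A L ϖ ^ m * ∏ j, y j ^ (e j).val) ∧
      z ^ N = algebraMap A B (∏ j, g j ^ (N / r j * (e j).val)) := by
  have hr0 : ∀ j, NeZero (r j) := fun j => ⟨ne_zero_of_dvd_ne_zero (NeZero.ne N) (hr j)⟩
  obtain ⟨m, hm⟩ := mem_ker_orderHom.1 he
  have hz : (algebraMap A L ϖ ^ (-m) * ∏ j, y j ^ (e j).val) ^ N =
      algebraMap A L (∏ j, g j ^ (N / r j * (e j).val)) := by
    rw [mul_pow, h.monomial_pow hr, hm, ← zpow_natCast (_ ^ (-m)), ← zpow_mul, ← mul_assoc,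
      ← zpow_add₀ h.algebraMap_ne_zero, neg_mul, mul_comm m, neg_add_cancel, zpow_zero, one_mul]
  have hint : IsIntegral A (algebraMap A L ϖ ^ (-m) * ∏ j, y j ^ (e j).val) :=
    .of_pow (NeZero.pos N) (hz ▸ isIntegral_algebraMap)
  refine ⟨IsIntegralClosure.mk' B _ hint, ⟨-m, IsIntegralClosure.algebraMap_mk' B _ hint⟩,
    IsIntegralClosure.algebraMap_injective B A L ?_⟩
  rw [map_pow, IsIntegralClosure.algebraMap_mk', hz, ← IsScalarTower.algebraMap_apply]

variable [Algebra F B] [IsScalarTower F A B] {P : Ideal B} [P.IsPrime]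

theorem notMem_of_mem (h : IsLocalKummer ϖ r k g b y) (hP : algebraMap A B ϖ ∈ P) (c : ι → ℕ) :
    algebraMap A B (∏ j, g j ^ c j) ∉ P := by
  have hϖ : algebraMap A (B ⧸ P) ϖ = 0 := Ideal.Quotient.eq_zero_iff_mem.2 hP
  rw [← Ideal.Quotient.eq_zero_iff_mem]
  exact fun h0 => ((∏ j, b j ^ c j : Fˣ).isUnit.map (algebraMap F (B ⧸ P))).ne_zero
    ((h.algebraMap_prod_eq hϖ c).symm.trans h0)

theorem hasPowerResidues_of_surjective [Algebra B L] [IsScalarTower A B L]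
    [IsIntegralClosure B A L] [FaithfulSMul A L] [NeZero N] (h : IsLocalKummer ϖ r k g b y)
    (hr : ∀ j, r j ∣ N) (hP : algebraMap A B ϖ ∈ P)
    (hsurj : Function.Surjective (algebraMap F (B ⧸ P))) : HasPowerResidues hr k b := by
  intro e he
  have hϖ : algebraMap A (B ⧸ P) ϖ = 0 := Ideal.Quotient.eq_zero_iff_mem.2 hP
  obtain ⟨z, -, hz⟩ := h.exists_integral_monomial (B := B) he
  obtain ⟨w, hw⟩ := hsurj (Ideal.Quotient.mk P z)
  have hpow : w ^ N = (∏ j, b j ^ (N / r j * (e j).val) : Fˣ) := by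
    refine (algebraMap F (B ⧸ P)).injective ?_
    rw [map_pow, hw, ← map_pow, hz, ← h.algebraMap_prod_eq hϖ]
    rfl
  have hunit : IsUnit w := (isUnit_pow_iff (NeZero.ne N)).1 (hpow ▸ Units.isUnit _)
  exact ⟨hunit.unit, Units.ext (by rw [Units.val_pow_eq_pow_val, IsUnit.unit_spec, hpow])⟩

theorem exists_sub_mem [NeZero N] [HasEnoughRootsOfUnity F N] (h : IsLocalKummer ϖ r k g b y)
    (hP : algebraMap A B ϖ ∈ P) {z : B} {c : ι → ℕ} (hz : z ^ N = algebraMap A B (∏ j, g j ^ c j))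
    {w : Fˣ} (hw : w ^ N = ∏ j, b j ^ c j) : ∃ w' : Fˣ, z - algebraMap F B w' ∈ P := by
  have hϖ : algebraMap A (B ⧸ P) ϖ = 0 := Ideal.Quotient.eq_zero_iff_mem.2 hP
  obtain ⟨ζ, -, hζ⟩ := exists_eq_rootsOfUnity_mul (F := F) (R := B ⧸ P)
    (x := algebraMap F (B ⧸ P) w) (z := Ideal.Quotient.mk P z) (N := N) (by
      rw [← map_pow, hz, ← map_pow, ← Units.val_pow_eq_pow_val, hw, ← h.algebraMap_prod_eq hϖ]
      rfl)
  refine ⟨ζ * w, ?_⟩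
  rw [← Ideal.Quotient.eq, hζ, ← map_mul, ← Units.val_mul]
  rfl

open IsDedekindDomain in
/-- The order at `P` of the `N`-th power of a monomial is divisible by `N`, and it is the
multiplicity of `P` times a lift of `orderHom hr k e`. -/
theorem multiplicity_nsmul_orderHom [IsDedekindDomain B] [Algebra B L] [IsFractionRing B L]
    [IsScalarTower A B L] [FaithfulSMul A L] [NeZero N] (h : IsLocalKummer ϖ r k g b y)
    (hr : ∀ j, r j ∣ N) (hP : algebraMap A B ϖ ∈ P) (e : ∀ j, ZMod (r j)) :
    multiplicity P (Ideal.span {algebraMap A B ϖ}) • orderHom hr k e = 0 := by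
  have hr0 : ∀ j, NeZero (r j) := fun j => ⟨ne_zero_of_dvd_ne_zero (NeZero.ne N) (hr j)⟩
  have hϖB : algebraMap A B ϖ ≠ 0 := fun h0 => h.algebraMap_ne_zero (by
    rw [IsScalarTower.algebraMap_apply A B L, h0, map_zero])
  let v : HeightOneSpectrum B := ⟨P, inferInstance, fun h0 => hϖB (by simpa [h0] using hP)⟩
  set m := multiplicity P (Ideal.span {algebraMap A B ϖ})
  have hv : v.valuation L (algebraMap A L ϖ) = WithZero.exp (-(m : ℤ)) := by
    rw [IsScalarTower.algebraMap_apply A B L, v.valuation_of_algebraMap,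
      v.intValuation_eq_exp_neg_multiplicity hϖB]
  have hlog := congrArg (fun x => WithZero.log (v.valuation L x))
    (h.monomial_pow hr fun j => (e j).val)
  simp only [map_pow, map_mul, map_zpow₀, hv, IsScalarTower.algebraMap_apply A B L (∏ _j, _),
    (v.valuation_eq_one_iff_notMem (K := L)).2 (h.notMem_of_mem hP _), mul_one, WithZero.log_pow,
    WithZero.log_zpow, WithZero.log_exp, nsmul_eq_mul, smul_eq_mul] at hlog
  rw [orderHom_apply, nsmul_eq_mul, ← Int.cast_natCast (R := ZMod N) m, ← Int.cast_mul,
    ZMod.intCast_zmod_eq_zero_iff_dvd]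
  exact ⟨-WithZero.log (v.valuation L (∏ j, y j ^ (e j).val)), by linarith⟩

section Count

variable (K : Type*) {B : Type*} [Field K] [Algebra A K] [IsFractionRing A K]
  [Algebra K L] [IsScalarTower A K L] [Algebra F L] [CommRing B] [Algebra A B] [Algebra B L]
  [IsScalarTower A B L] [IsIntegralClosure B A L] [Algebra F B] [IsScalarTower F A B]
  [IsScalarTower F B L] [FiniteDimensional K L] [NeZero N] [HasEnoughRootsOfUnity F N]

theorem card_ker_le_ncard_primesOver [IsGalois K L] [FaithfulSMul A L]
    (h : IsLocalKummer ϖ r k g b y) (hy : IsFullKummer K r y) {hr : ∀ j, r j ∣ N}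
    (hfin : ((Ideal.span {ϖ}).primesOver B).Finite) {P : Ideal B}
    (hP : P ∈ (Ideal.span {ϖ}).primesOver B) (hb : HasPowerResidues hr k b) :
    Nat.card (orderHom hr k).ker ≤ ((Ideal.span {ϖ}).primesOver B).ncard := by
  obtain ⟨hPprime, hPover⟩ := id hP
  have hr0 : ∀ j, NeZero (r j) := fun j => ⟨ne_zero_of_dvd_ne_zero (NeZero.ne N) (hr j)⟩
  let U : Subgroup (Multiplicative (∀ j, ZMod (r j))) := (orderHom hr k).ker.toSubgroup
  choose z hzmon hzpow using fun e : U => h.exists_integral_monomial (B := B) (e := e.1.toAdd) e.2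
  choose w hw using fun e : U => h.exists_sub_mem
    (algebraMap_mem_of_liesOver_span_singleton P) (hzpow e) (hb _ e.2).choose_spec
  choose τ hτ using hy.exists_algEquiv_of_monoidHom hr (F := F) (U := U)
  have hσ : ∀ φ e, galRestrict A K L B (τ φ) (z e) = algebraMap F B (φ e) * z e := fun φ e => by
    obtain ⟨m, hm⟩ := hzmon e
    refine IsIntegralClosure.algebraMap_injective B A L ?_
    rw [algebraMap_galRestrict_apply, hm, map_mul, hτ, map_mul, hm, map_zpow₀,
      IsScalarTower.algebraMap_apply A K L, AlgEquiv.commutes, mul_left_comm,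
      IsScalarTower.algebraMap_apply F B L]
  have : Finite (Multiplicative (∀ j, ZMod (r j))) := inferInstanceAs (Finite (∀ j, ZMod (r j)))
  have : HasEnoughRootsOfUnity F (Monoid.exponent U) :=
    .of_dvd F ((Monoid.exponent_submonoid_dvd U.toSubmonoid).trans
      (exponent_multiplicative_pi_zmod_dvd hr))
  calc Nat.card (orderHom hr k).ker = Nat.card (U →* Fˣ) :=
        (CommGroup.card_monoidHom_of_hasEnoughRootsOfUnity U F).symm
    _ ≤ _ := natCard_monoidHom_le_ncard_primesOver hfin hP hw hσ

variable [IsDedekindDomain A]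

theorem ncard_primesOver_eq_and_inertiaDeg_eq_one [IsGalois K L] [FaithfulSMul A L]
    (h : IsLocalKummer ϖ r k g b y) (hy : IsFullKummer K r y) {hr : ∀ j, r j ∣ N}
    (hb : HasPowerResidues hr k b) :
    ((Ideal.span {ϖ}).primesOver B).ncard = Nat.card (orderHom hr k).ker ∧
      ∀ P ∈ (Ideal.span {ϖ}).primesOver B, P.inertiaDeg A = 1 := by
  have (j : ι) : NeZero (r j) := ⟨ne_zero_of_dvd_ne_zero (NeZero.ne N) (hr j)⟩
  have : IsDomain B := (IsIntegralClosure.algebraMap_injective B A L).isDomain _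
  have := IsIntegralClosure.isDedekindDomain A K L B
  have := IsIntegralClosure.isFractionRing_of_finite_extension A K L B
  have := IsIntegralClosure.finite A K L B
  have : FaithfulSMul A B := .tower_bot A B L
  have := h.isMaximal
  have hfin : ((Ideal.span {ϖ}).primesOver B).Finite := IsDedekindDomain.primesOver_finite _ _
  have hrank : Module.finrank A B =
      Nat.card (orderHom hr k).ker * Nat.card (orderHom hr k).range := by
    rw [← IsFractionRing.finrank_eq A K B L, hy.finrank_eq, ← AddSubgroup.index_ker,
      AddSubgroup.card_mul_index, Nat.card_pi]
    simp only [Nat.card_zmod]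
  have hϖB : Ideal.span {algebraMap A B ϖ} ≠ ⊥ := by
    simpa [FaithfulSMul.algebraMap_eq_zero_iff] using h.prime.ne_zero
  have hram : ∀ P ∈ (Ideal.span {ϖ}).primesOver B,
      Nat.card (orderHom hr k).range ≤ P.ramificationIdx A := by
    rintro P ⟨hPprime, hPover⟩
    have hϖP := algebraMap_mem_of_liesOver_span_singleton (ϖ := ϖ) P
    rw [Ideal.IsDedekindDomain.ramificationIdx_eq_multiplicity (Ideal.span {ϖ}) P
      (by rwa [Ideal.map_span, Set.image_singleton]), Ideal.map_span, Set.image_singleton]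
    refine natCard_le_of_forall_nsmul_eq_zero ?_ ?_
    · exact multiplicity_pos_of_dvd (Ideal.dvd_span_singleton.2 hϖP)
    · rintro ⟨_, e, rfl⟩
      exact Subtype.ext (h.multiplicity_nsmul_orderHom hr hϖP e)
  obtain ⟨P, hP⟩ : Nonempty ((Ideal.span {ϖ}).primesOver B) := inferInstance
  exact AbelianCover.ncard_primesOver_eq_and_inertiaDeg_eq_one hfin Nat.card_pos hrank hram
    (h.card_ker_le_ncard_primesOver K hy hfin hP hb)

open Classical in
theorem ncard_rationalPrimesOver [IsGalois K L] [FaithfulSMul A L]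
    (h : IsLocalKummer ϖ r k g b y) (hy : IsFullKummer K r y) (hr : ∀ j, r j ∣ N)
    (hF : Function.Surjective (algebraMap F (A ⧸ Ideal.span {ϖ}))) :
    (rationalPrimesOver F (Ideal.span {ϖ}) B).ncard =
      if HasPowerResidues hr k b then Nat.card (orderHom hr k).ker else 0 := by
  split_ifs with hb
  · obtain ⟨hncard, hinertia⟩ := h.ncard_primesOver_eq_and_inertiaDeg_eq_one K (B := B) hy hb
    rw [← hncard]
    congr 1
    refine Set.sep_eq_self_iff_mem_true.2 fun P hP => ?_
    obtain ⟨hPprime, hPover⟩ := id hP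
    have := h.isMaximal
    have : Algebra.IsIntegral A B := IsIntegralClosure.isIntegral_algebra A L
    have : P.IsMaximal := Ideal.IsMaximal.of_liesOver_isMaximal P (Ideal.span {ϖ})
    have hcomp := (surjective_algebraMap_quotient_of_inertiaDeg_eq_one (hinertia P hP)).comp hF
    rwa [← RingHom.coe_comp, ← IsScalarTower.algebraMap_eq] at hcomp
  · convert Set.ncard_empty (Ideal B)
    rw [Set.eq_empty_iff_forall_notMem]
    rintro P ⟨⟨hPprime, hPover⟩, hsurj⟩
    exact hb (h.hasPowerResidues_of_surjective (B := B) hr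
      (algebraMap_mem_of_liesOver_span_singleton P) hsurj)

end Count

end IsLocalKummer

end LocalKummer

section RationalPoints

open IsDedekindDomain

variable {F L : Type*} [Field F] [Field L] [Algebra F L]

theorem IsCurvePoint.toResidueField_eq_residue_iff {V : ValuationSubring L} (h : IsCurvePoint F V)
    (x : V) (c : F) : h.toResidueField c = IsLocalRing.residue V x ↔
      V.valuation ((x : L) - algebraMap F L c) < 1 := by
  have hc : h.toResidueField c = IsLocalRing.residue V ⟨algebraMap F L c, h.const_mem c⟩ := rfl
  rw [hc, eq_comm, ← sub_eq_zero, ← map_sub, IsLocalRing.residue_eq_zero_iff,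
    ValuationSubring.valuation_lt_one_iff]
  rfl

theorem mem_rationalPoints_iff {V : ValuationSubring L} :
    V ∈ rationalPoints F L ↔ (∀ a : F, algebraMap F L a ∈ V) ∧ IsDiscreteValuationRing V ∧
      ∀ x ∈ V, ∃ c : F, V.valuation (x - algebraMap F L c) < 1 := by
  constructor
  · rintro ⟨h, hbij⟩
    refine ⟨h.const_mem, h.dvr, fun x hx => ?_⟩
    obtain ⟨c, hc⟩ := hbij.2 (IsLocalRing.residue V ⟨x, hx⟩)
    exact ⟨c, (h.toResidueField_eq_residue_iff ⟨x, hx⟩ c).1 hc⟩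
  · rintro ⟨hconst, hdvr, hres⟩
    refine ⟨⟨hconst, hdvr⟩, RingHom.injective _, fun z => ?_⟩
    obtain ⟨x, rfl⟩ := IsLocalRing.residue_surjective z
    obtain ⟨c, hc⟩ := hres x x.2
    exact ⟨c, (IsCurvePoint.toResidueField_eq_residue_iff _ x c).2 hc⟩

/-- The rational points at which `t` vanishes. -/
def rationalZeros (F : Type*) {L : Type*} [Field F] [Field L] [Algebra F L] (t : L) :
    Set (ValuationSubring L) :=
  {V | V ∈ rationalPoints F L ∧ V.valuation t < 1}

theorem valuation_lt_one_valuationSubring_iff {Γ : Type*} [LinearOrderedCommGroupWithZero Γ]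
    (v : Valuation L Γ) (x : L) : v.valuationSubring.valuation x < 1 ↔ v x < 1 :=
  (v.isEquiv_valuation_valuationSubring.lt_one_iff_lt_one).symm

section Dedekind

variable {B : Type*} [CommRing B] [IsDedekindDomain B] [Algebra B L] [IsFractionRing B L]

theorem isDiscreteValuationRing_valuationSubring (v : HeightOneSpectrum B) :
    IsDiscreteValuationRing (v.valuation L).valuationSubring := by
  rw [← HeightOneSpectrum.valuationSubringAtPrime_eq_valuationSubring]
  have := v.isPrime
  exact IsLocalization.AtPrime.isDiscreteValuationRing_of_dedekind_domain _ v.ne_bot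
    (HeightOneSpectrum.valuationSubringAtPrime L v)

theorem valuationSubring_mem_rationalPoints_iff [Algebra F B] [IsScalarTower F B L]
    (v : HeightOneSpectrum B) : (v.valuation L).valuationSubring ∈ rationalPoints F L ↔
      Function.Surjective (algebraMap F (B ⧸ v.asIdeal)) := by
  have residue_eq_iff (x : B) (c : F) : algebraMap F (B ⧸ v.asIdeal) c = Ideal.Quotient.mk _ x ↔
      v.valuation L (algebraMap B L x - algebraMap F L c) < 1 := by
    rw [eq_comm, IsScalarTower.algebraMap_apply F B L, ← map_sub, v.valuation_lt_one_iff_mem,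
      ← Ideal.Quotient.eq]
    rfl
  simp only [mem_rationalPoints_iff, valuation_lt_one_valuationSubring_iff,
    Valuation.mem_valuationSubring_iff, isDiscreteValuationRing_valuationSubring, true_and]
  constructor
  · rintro ⟨-, hres⟩ z
    obtain ⟨x, rfl⟩ := Ideal.Quotient.mk_surjective z
    obtain ⟨c, hc⟩ := hres _ (v.valuation_le_one x)
    exact ⟨c, (residue_eq_iff x c).2 hc⟩
  · refine fun hsurj => ⟨fun a => ?_, fun x hx => ?_⟩
    · rw [IsScalarTower.algebraMap_apply F B L]
      exact v.valuation_le_one _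
    · obtain ⟨a, ha⟩ := v.exists_valuation_sub_lt_of_integer hx 1
      obtain ⟨c, hc⟩ := hsurj (Ideal.Quotient.mk _ a)
      refine ⟨c, ?_⟩
      rw [Units.val_one, Valuation.map_sub_swap] at ha
      rw [← sub_add_sub_cancel _ (algebraMap B L a)]
      exact (Valuation.map_add _ _ _).trans_lt (max_lt ha ((residue_eq_iff a c).1 hc))

omit [IsDedekindDomain B] [IsFractionRing B L] in
theorem mem_of_algebraMap_mul_eq {V : ValuationSubring L} (hB : ∀ x : B, algebraMap B L x ∈ V)
    {x : L} {a b : B} (hb : ¬V.valuation (algebraMap B L b) < 1)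
    (hx : x * algebraMap B L b = algebraMap B L a) : x ∈ V := by
  have hb1 : V.valuation (algebraMap B L b) = 1 :=
    le_antisymm ((V.valuation_le_one_iff _).2 (hB b)) (not_lt.1 hb)
  have hxa := congrArg V.valuation hx
  rw [map_mul, hb1, mul_one] at hxa
  rw [← V.valuation_le_one_iff, hxa, V.valuation_le_one_iff]
  exact hB a

theorem exists_valuationSubring_eq {V : ValuationSubring L} (hV : V ≠ ⊤)
    (hB : ∀ x : B, algebraMap B L x ∈ V) :
    ∃ v : HeightOneSpectrum B, (v.valuation L).valuationSubring = V := by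
  let P : Ideal B := (IsLocalRing.maximalIdeal V).comap
    ((algebraMap B L).codRestrict V.toSubring hB)
  have mem_P_iff (x : B) : x ∈ P ↔ V.valuation (algebraMap B L x) < 1 :=
    V.valuation_lt_one_iff ((algebraMap B L).codRestrict V.toSubring hB x)
  have hP : P ≠ ⊥ := by
    rintro hbot
    refine hV (top_le_iff.1 fun x _ => ?_)
    obtain ⟨a, b, hb, rfl⟩ := IsFractionRing.div_surjective (A := B) x
    have hb0 : b ≠ 0 := nonZeroDivisors.ne_zero hb
    refine mem_of_algebraMap_mul_eq hB (a := a) (b := b) ?_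
      (div_mul_cancel₀ _ (IsFractionRing.to_map_ne_zero_of_mem_nonZeroDivisors hb))
    rwa [← mem_P_iff, hbot, Ideal.mem_bot]
  let v : HeightOneSpectrum B := ⟨P, inferInstance, hP⟩
  refine ⟨v, ?_⟩
  rw [← HeightOneSpectrum.valuationSubringAtPrime_eq_valuationSubring]
  refine ValuationSubring.eq_of_le_of_ne_top _ (fun x hx => ?_) hV
  rw [HeightOneSpectrum.valuationSubringAtPrime_eq_valuationSubring,
    Valuation.mem_valuationSubring_iff] at hx
  obtain ⟨a, ⟨b, hb⟩, hab⟩ := v.exists_primeCompl_mul_eq_of_integer x hx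
  exact mem_of_algebraMap_mul_eq hB (fun h => hb ((mem_P_iff b).2 h)) hab

theorem valuationSubring_injective : Function.Injective
    fun v : HeightOneSpectrum B => (v.valuation L).valuationSubring := fun _ _ h =>
  HeightOneSpectrum.eq_of_valuation_isEquiv_valuation
    ((Valuation.isEquiv_iff_valuationSubring _ _).2 h)

end Dedekind

theorem ne_top_of_valuation_lt_one {V : ValuationSubring L} {t : L} (ht : t ≠ 0)
    (h : V.valuation t < 1) : V ≠ ⊤ := by
  rintro rfl
  have hinv : (⊤ : ValuationSubring L).valuation t⁻¹ ≤ 1 :=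
    (ValuationSubring.valuation_le_one_iff _ _).2 (ValuationSubring.mem_top _)
  rw [map_inv₀, inv_le_one₀ ((Valuation.pos_iff _).2 ht)] at hinv
  exact hinv.not_gt h

variable {A : Type*} [CommRing A] [Algebra F A] [Algebra A L] [IsScalarTower F A L] {ϖ : A}

theorem algebraMap_mem_of_adjoin (hadj : Algebra.adjoin F {ϖ} = ⊤) {V : ValuationSubring L}
    (hV : ∀ a : F, algebraMap F L a ∈ V) (hϖ : algebraMap A L ϖ ∈ V) (a : A) :
    algebraMap A L a ∈ V := by
  have ha : a ∈ Algebra.adjoin F {ϖ} := hadj ▸ Algebra.mem_top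
  induction ha using Algebra.adjoin_induction with
  | mem x hx => rw [Set.mem_singleton_iff.1 hx]; exact hϖ
  | algebraMap c => rw [← IsScalarTower.algebraMap_apply]; exact hV c
  | add x z _ _ hx hz => rw [map_add]; exact V.add_mem _ _ hx hz
  | mul x z _ _ hx hz => rw [map_mul]; exact V.mul_mem _ _ hx hz

theorem surjective_algebraMap_quotient_of_adjoin (hadj : Algebra.adjoin F {ϖ} = ⊤) :
    Function.Surjective (algebraMap F (A ⧸ Ideal.span {ϖ})) := by
  have hrange : (Ideal.Quotient.mkₐ F (Ideal.span {ϖ})).range = ⊥ := by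
    rw [← Algebra.map_top, ← hadj, AlgHom.map_adjoin_singleton, Ideal.Quotient.mkₐ_eq_mk,
      Ideal.Quotient.mk_singleton_self, Algebra.adjoin_singleton_zero]
  intro z
  obtain ⟨a, rfl⟩ := Ideal.Quotient.mk_surjective z
  exact Algebra.mem_bot.1 (hrange ▸ AlgHom.mem_range_self _ a)

variable {B : Type*} [CommRing B] [Algebra A B] [Algebra B L] [IsScalarTower A B L]

omit [Algebra F A] [IsScalarTower F A L] [Algebra F L] in
theorem algebraMap_mem_of_isIntegral [Algebra.IsIntegral A B] {V : ValuationSubring L}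
    (hA : ∀ a : A, algebraMap A L a ∈ V) (x : B) : algebraMap B L x ∈ V := by
  let : Algebra A V := ((algebraMap A L).codRestrict V.toSubring hA).toAlgebra
  have : IsScalarTower A V L := .of_algebraMap_eq fun _ => rfl
  have hint : IsIntegral V (algebraMap B L x) :=
    ((Algebra.IsIntegral.isIntegral (R := A) x).algebraMap).tower_top
  obtain ⟨w, hw⟩ := IsIntegrallyClosed.isIntegral_iff.1 hint
  rw [← hw]
  exact w.2

variable [IsDedekindDomain B] [IsFractionRing B L] [Algebra F B] [IsScalarTower F B L]

omit [Algebra F A] [IsScalarTower F A L] in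
theorem valuationSubring_mem_rationalZeros_iff [(Ideal.span {ϖ}).IsMaximal]
    (v : HeightOneSpectrum B) :
    (v.valuation L).valuationSubring ∈ rationalZeros F (algebraMap A L ϖ) ↔
      v.asIdeal ∈ rationalPrimesOver F (Ideal.span {ϖ}) B := by
  have hover : algebraMap A B ϖ ∈ v.asIdeal ↔ v.asIdeal.LiesOver (Ideal.span {ϖ}) := by
    refine ⟨fun h => ⟨?_⟩, fun h => algebraMap_mem_of_liesOver_span_singleton _⟩
    refine Ideal.IsMaximal.eq_of_le ‹_› (Ideal.IsPrime.ne_top inferInstance) ?_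
    rwa [Ideal.span_singleton_le_iff_mem]
  rw [rationalZeros, Set.mem_ofPred_eq, valuationSubring_mem_rationalPoints_iff,
    valuation_lt_one_valuationSubring_iff, IsScalarTower.algebraMap_apply A B L,
    v.valuation_lt_one_iff_mem, hover, and_comm]
  exact and_congr_left fun _ => ⟨fun h => ⟨v.isPrime, h⟩, fun h => h.2⟩

theorem finite_rationalZeros_and_ncard_eq [IsDedekindDomain A] [FaithfulSMul A L]
    [Algebra.IsIntegral A B] (hϖ : Prime ϖ) (hadj : Algebra.adjoin F {ϖ} = ⊤) :
    (rationalZeros F (algebraMap A L ϖ)).Finite ∧ (rationalZeros F (algebraMap A L ϖ)).ncard =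
      (rationalPrimesOver F (Ideal.span {ϖ}) B).ncard := by
  have hϖ0 : algebraMap A L ϖ ≠ 0 :=
    (map_ne_zero_iff _ (FaithfulSMul.algebraMap_injective A L)).2 hϖ.ne_zero
  have hprime : (Ideal.span {ϖ}).IsPrime := (Ideal.span_singleton_prime hϖ.ne_zero).2 hϖ
  have hbot : Ideal.span {ϖ} ≠ ⊥ := by simpa using hϖ.ne_zero
  have hmax : (Ideal.span {ϖ}).IsMaximal := hprime.isMaximal hbot
  have himage : rationalZeros F (algebraMap A L ϖ) =
      (fun v : HeightOneSpectrum B => (v.valuation L).valuationSubring) ''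
        (HeightOneSpectrum.asIdeal ⁻¹' rationalPrimesOver F (Ideal.span {ϖ}) B) := by
    ext V
    refine ⟨fun hV => ?_, ?_⟩
    · obtain ⟨v, rfl⟩ := exists_valuationSubring_eq (B := B) (ne_top_of_valuation_lt_one hϖ0 hV.2)
        (algebraMap_mem_of_isIntegral (algebraMap_mem_of_adjoin hadj
          (mem_rationalPoints_iff.1 hV.1).1 ((V.valuation_le_one_iff _).1 hV.2.le)))
      exact ⟨v, (valuationSubring_mem_rationalZeros_iff v).1 hV, rfl⟩
    · rintro ⟨v, hv, rfl⟩
      exact (valuationSubring_mem_rationalZeros_iff v).2 hv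
  have : FaithfulSMul A B := .tower_bot A B L
  have hfin := IsDedekindDomain.primesOver_finite (Ideal.span {ϖ}) B
  have hrange : rationalPrimesOver F (Ideal.span {ϖ}) B ⊆
      Set.range (HeightOneSpectrum.asIdeal (R := B)) := fun P hP => by
    have := hP.1.2
    exact ⟨⟨P, hP.1.1, Ideal.ne_bot_of_liesOver_of_ne_bot hbot P⟩, rfl⟩
  have hinj : Function.Injective (HeightOneSpectrum.asIdeal (R := B)) :=
    fun _ _ => HeightOneSpectrum.ext
  rw [himage]
  refine ⟨((hfin.subset fun _ h => h.1).preimage hinj.injOn).image _, ?_⟩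
  rw [Set.ncard_image_of_injective _ valuationSubring_injective,
    Set.ncard_preimage_of_injective_subset_range hinj hrange]

open Classical in
theorem IsLocalKummer.finite_rationalZeros_and_ncard_eq {ι : Type*} [Fintype ι] [IsDedekindDomain A]
    (K : Type*) [Field K] [Algebra A K] [IsFractionRing A K] [Algebra K L] [IsScalarTower A K L]
    [FiniteDimensional K L] [IsGalois K L] {r : ι → ℕ} {k : ι → ℤ} {g : ι → A} {b : ι → Fˣ}
    {y : ι → L} {N : ℕ} [NeZero N] [HasEnoughRootsOfUnity F N] (h : IsLocalKummer ϖ r k g b y)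
    (hy : IsFullKummer K r y) (hr : ∀ j, r j ∣ N) (hadj : Algebra.adjoin F {ϖ} = ⊤) :
    (rationalZeros F (algebraMap A L ϖ)).Finite ∧ (rationalZeros F (algebraMap A L ϖ)).ncard =
      if HasPowerResidues hr k b then Nat.card (orderHom hr k).ker else 0 := by
  have : FaithfulSMul A L := (faithfulSMul_iff_algebraMap_injective A L).2 <| by
    rw [IsScalarTower.algebraMap_eq A K L]
    exact (algebraMap K L).injective.comp (IsFractionRing.injective A K)
  have := integralClosure.isDedekindDomain A K L
  have := integralClosure.isFractionRing_of_finite_extension (A := A) K L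
  rw [← h.ncard_rationalPrimesOver (B := integralClosure A L) K hy hr
    (surjective_algebraMap_quotient_of_adjoin hadj)]
  exact AbelianCover.finite_rationalZeros_and_ncard_eq h.prime hadj

open Classical in
theorem IsFullKummer.finite_rationalZeros_and_ncard_eq {ι K : Type*} [Fintype ι] [Field K]
    [Algebra F K] [Algebra K L] [IsScalarTower F K L] [FiniteDimensional K L] [IsGalois K L]
    {r : ι → ℕ} {k : ι → ℤ} {g : ι → F[X]} {b : ι → Fˣ} {y : ι → L} {N : ℕ} [NeZero N]
    [HasEnoughRootsOfUnity F N] (hy : IsFullKummer K r y) (hr : ∀ j, r j ∣ N) {t : K}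
    (ht : Transcendental F t) (hfrac : ∀ z : K, ∃ p q : F[X], z = aeval t p / aeval t q)
    (hb : ∀ j, (g j).eval 0 = b j)
    (hroot : ∀ j, y j ^ r j = algebraMap K L (t ^ k j * aeval t (g j))) :
    (rationalZeros F (algebraMap K L t)).Finite ∧ (rationalZeros F (algebraMap K L t)).ncard =
      if HasPowerResidues hr k b then Nat.card (orderHom hr k).ker else 0 := by
  let : Algebra F[X] K := (aeval t : F[X] →ₐ[F] K).toAlgebra
  let : Algebra F[X] L := ((algebraMap K L).comp (algebraMap F[X] K)).toAlgebra
  have hK (p : F[X]) : algebraMap F[X] K p = aeval t p := rfl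
  have : IsScalarTower F[X] K L := .of_algebraMap_eq fun _ => rfl
  have : IsScalarTower F F[X] K := .of_algebraMap_eq fun c => (aeval_C t c).symm
  have : IsScalarTower F F[X] L := .of_algebraMap_eq fun c => by
    rw [IsScalarTower.algebraMap_apply F K L, IsScalarTower.algebraMap_apply F F[X] K,
      IsScalarTower.algebraMap_apply F[X] K L]
  have : FaithfulSMul F[X] K :=
    (faithfulSMul_iff_algebraMap_injective _ _).2 (transcendental_iff_injective.1 ht)
  have : IsFractionRing F[X] K := .of_field _ _ hfrac
  have h : IsLocalKummer (X : F[X]) r k g b y :=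
    { prime := prime_X
      dvd_sub := fun j => by simp [X_dvd_iff, coeff_zero_eq_eval_zero, hb]
      root := fun j => by
        rw [hroot, IsScalarTower.algebraMap_apply F[X] K L, IsScalarTower.algebraMap_apply F[X] K L,
          hK, hK, aeval_X, map_mul, map_zpow₀] }
  have hX : algebraMap F[X] L X = algebraMap K L t := by
    rw [IsScalarTower.algebraMap_apply F[X] K L, hK, aeval_X]
  rw [← hX]
  exact h.finite_rationalZeros_and_ncard_eq K hy hr Polynomial.adjoin_X

end RationalPoints

section Line

variable {F : Type*} [Field F]

/-- The uniformizer of `F(X)` at a point of the projective line over `F`. -/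
noncomputable def uniformizer : OnePoint F → RatFunc F
  | OnePoint.some x => algebraMap F[X] (RatFunc F) (X - C x)
  | OnePoint.infty => (RatFunc.X)⁻¹

theorem uniformizer_coe (x : F) :
    uniformizer (OnePoint.some x) = RatFunc.X - algebraMap F (RatFunc F) x := by
  simp [uniformizer, RatFunc.algebraMap_eq_C]

theorem uniformizer_infty : uniformizer (OnePoint.infty : OnePoint F) = (RatFunc.X)⁻¹ := rfl

theorem transcendental_uniformizer (x : OnePoint F) : Transcendental F (uniformizer x) := by
  have hX : Transcendental F (RatFunc.X : RatFunc F) := RatFunc.transcendental_X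
  induction x using OnePoint.rec with
  | infty => exact fun h => hX (IsAlgebraic.inv_iff.1 h)
  | coe x =>
    intro h
    rw [uniformizer_coe] at h
    exact hX (by simpa using h.add (isAlgebraic_algebraMap (R := F) (A := RatFunc F) x))

theorem aeval_uniformizer_coe (x : F) (p : F[X]) :
    aeval (uniformizer (OnePoint.some x)) p = algebraMap F[X] (RatFunc F) (p.comp (X - C x)) := by
  change aeval (algebraMap F[X] (RatFunc F) (X - C x)) p = _
  rw [aeval_algebraMap_apply, comp, aeval_def, Polynomial.algebraMap_eq]

theorem algebraMap_eq_uniformizer_infty_zpow_mul (p : F[X]) :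
    algebraMap F[X] (RatFunc F) p = uniformizer (OnePoint.infty : OnePoint F) ^
      (-(p.natDegree : ℤ)) * aeval (uniformizer (OnePoint.infty : OnePoint F)) p.reverse := by
  let : Invertible (RatFunc.X : RatFunc F) := invertibleOfNonzero RatFunc.X_ne_zero
  have h := eval₂_reverse_mul_pow (algebraMap F (RatFunc F)) (RatFunc.X : RatFunc F) p
  rw [invOf_eq_inv, ← aeval_def, ← aeval_def] at h
  rw [uniformizer_infty, inv_zpow', neg_neg, zpow_natCast, mul_comm, h, ← RatFunc.algebraMap_X,
    aeval_algebraMap_apply, aeval_X_left_apply]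

theorem exists_eq_aeval_uniformizer_div (x : OnePoint F) (z : RatFunc F) :
    ∃ p q : F[X], z = aeval (uniformizer x) p / aeval (uniformizer x) q := by
  rw [← RatFunc.num_div_denom z]
  induction x using OnePoint.rec with
  | infty =>
    set t := uniformizer (OnePoint.infty : OnePoint F) with ht
    have ht0 : t ≠ 0 := inv_ne_zero RatFunc.X_ne_zero
    refine ⟨X ^ z.denom.natDegree * z.num.reverse, X ^ z.num.natDegree * z.denom.reverse, ?_⟩
    rw [algebraMap_eq_uniformizer_infty_zpow_mul, algebraMap_eq_uniformizer_infty_zpow_mul, ← ht]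
    simp only [map_mul, map_pow, aeval_X, zpow_neg, zpow_natCast]
    by_cases h0 : aeval t z.denom.reverse = 0
    · simp [h0]
    field_simp
  | coe x =>
    refine ⟨z.num.comp (X + C x), z.denom.comp (X + C x), ?_⟩
    rw [aeval_uniformizer_coe, aeval_uniformizer_coe, comp_assoc, comp_assoc]
    simp

variable {L : Type*} [Field L] [Algebra (RatFunc F) L] [Algebra F L]
  [IsScalarTower F (RatFunc F) L]

theorem existsUnique_mem_rationalZeros_uniformizer {V : ValuationSubring L}
    (hV : V ∈ rationalPoints F L) :
    ∃! x : OnePoint F, V ∈ rationalZeros F (algebraMap (RatFunc F) L (uniformizer x)) := by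
  set X' : L := algebraMap (RatFunc F) L RatFunc.X with hX'
  have hcoe (c : F) : algebraMap (RatFunc F) L (uniformizer (OnePoint.some c)) =
      X' - algebraMap F L c := by
    rw [uniformizer_coe, map_sub, ← IsScalarTower.algebraMap_apply]
  have hinfty : algebraMap (RatFunc F) L (uniformizer (OnePoint.infty : OnePoint F)) = X'⁻¹ :=
    map_inv₀ _ _
  have hX0 : 0 < V.valuation X' := by simpa [hX', Valuation.pos_iff] using RatFunc.X_ne_zero
  obtain ⟨h, hbij⟩ := id hV
  by_cases hX : X' ∈ V
  · have hmem (c : F) : V ∈ rationalZeros F (algebraMap (RatFunc F) L (uniformizer c)) ↔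
        h.toResidueField c = IsLocalRing.residue V ⟨X', hX⟩ := by
      rw [h.toResidueField_eq_residue_iff, rationalZeros, Set.mem_ofPred_eq, hcoe,
        and_iff_right hV]
    obtain ⟨c, hc, huniq⟩ := hbij.existsUnique (IsLocalRing.residue V ⟨X', hX⟩)
    refine ⟨c, (hmem c).2 hc, fun x hx => ?_⟩
    induction x using OnePoint.rec with
    | infty =>
      refine absurd hx.2 (not_lt.2 ?_)
      rw [hinfty, map_inv₀]
      exact (one_le_inv₀ hX0).2 ((V.valuation_le_one_iff _).2 hX)
    | coe x => rw [huniq x ((hmem x).1 hx)]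
  · refine ⟨OnePoint.infty, ⟨hV, ?_⟩, fun x hx => ?_⟩
    · rw [hinfty, map_inv₀]
      exact inv_lt_one_of_one_lt₀ (not_le.1 ((V.valuation_le_one_iff _).not.2 hX))
    · induction x using OnePoint.rec with
      | infty => rfl
      | coe x =>
        refine absurd ?_ hX
        have hlt := hx.2
        rw [hcoe] at hlt
        simpa using V.add_mem _ _ ((V.valuation_le_one_iff _).1 hlt.le) (h.const_mem x)

theorem ncard_rationalPoints_eq_sum [Fintype F]
    (hfin : ∀ x : OnePoint F, (rationalZeros F (algebraMap (RatFunc F) L (uniformizer x))).Finite) :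
    (rationalPoints F L).Finite ∧ (rationalPoints F L).ncard =
      ∑ x : OnePoint F, (rationalZeros F (algebraMap (RatFunc F) L (uniformizer x))).ncard := by
  have hunion : rationalPoints F L =
      ⋃ x : OnePoint F, rationalZeros F (algebraMap (RatFunc F) L (uniformizer x)) := by
    ext V
    rw [Set.mem_iUnion]
    exact ⟨fun hV => (existsUnique_mem_rationalZeros_uniformizer hV).exists, fun ⟨_, h⟩ => h.1⟩
  rw [hunion, Set.ncard_iUnion_of_finite hfin, finsum_eq_sum_of_fintype]
  · exact ⟨Set.finite_iUnion hfin, rfl⟩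
  · exact fun x x' hne => Set.disjoint_left.2 fun V h h' =>
      hne ((existsUnique_mem_rationalZeros_uniformizer h.1).unique h h')

end Line

section Reindexing

theorem addOrderOf_natCast_mul_div {r s a : ℕ} [NeZero r] (hs : s ∣ r) (ha : a.Coprime s) :
    addOrderOf ((a * (r / s) : ℕ) : ZMod r) = s := by
  have hgcd : r.gcd (a * (r / s)) = r / s := by
    calc r.gcd (a * (r / s)) = (s * (r / s)).gcd (a * (r / s)) := by rw [Nat.mul_div_cancel' hs]
      _ = r / s := by rw [Nat.gcd_mul_right, ha.symm.gcd_eq_one, one_mul]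
  rw [ZMod.addOrderOf_coe _ (NeZero.ne r), hgcd, Nat.div_div_self hs (NeZero.ne r)]

theorem injOn_natCast_mul_div {r s u : ℕ} [NeZero r] (hs : s ∣ r) (hu : u.Coprime s) :
    Set.InjOn (fun w => ((u * w * (r / s) : ℕ) : ZMod r)) (Finset.Icc 1 s) := by
  intro w hw w' hw' h
  have hr : s * (r / s) = r := Nat.mul_div_cancel' hs
  have hmod : u * w * (r / s) ≡ u * w' * (r / s) [MOD s * (r / s)] := by
    rw [hr]
    exact (ZMod.natCast_eq_natCast_iff _ _ _).1 h
  have hmod' : w ≡ w' [MOD s] := (hmod.mul_right_cancel'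
    (Nat.div_ne_zero_iff_of_dvd hs |>.2 ⟨NeZero.ne r, ne_zero_of_dvd_ne_zero (NeZero.ne r) hs⟩)
    ).cancel_left_of_coprime hu.symm
  refine Nat.mod_injOn_Ico 1 s ?_ ?_ hmod' <;>
    simp only [Finset.coe_Icc, Finset.coe_Ico, Set.mem_Icc, Set.mem_Ico] at * <;> omega

theorem card_filter_coprime_Icc (s : ℕ) :
    ((Finset.Icc 1 s).filter fun w => w.Coprime s).card = s.totient := by
  rw [← Nat.filter_coprime_Ico_eq_totient s 1]
  congr 1
  ext w
  simp only [Finset.mem_filter, Finset.mem_Icc, Finset.mem_Ico, Nat.coprime_comm (n := w)]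
  omega

theorem image_natCast_mul_div {r s u : ℕ} [NeZero r] (hs : s ∣ r) (hu : u.Coprime s) :
    (((Finset.Icc 1 s).filter fun w => w.Coprime s).image
      fun w => ((u * w * (r / s) : ℕ) : ZMod r)) =
        Finset.univ.filter fun x => addOrderOf x = s := by
  refine Finset.eq_of_subset_of_card_le (fun x hx => ?_) ?_
  · obtain ⟨w, hw, rfl⟩ := Finset.mem_image.1 hx
    exact Finset.mem_filter.2 ⟨Finset.mem_univ _,
      addOrderOf_natCast_mul_div hs (hu.mul_left (Finset.mem_filter.1 hw).2)⟩
  · rw [IsAddCyclic.card_addOrderOf_eq_totient (by rwa [ZMod.card]), Finset.card_image_of_injOn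
      ((injOn_natCast_mul_div hs hu).mono (Finset.filter_subset _ _)), card_filter_coprime_Icc]

variable {n : ℕ} {r : Fin n → ℕ}

theorem dvd_of_mem_divisorVectors {s : Fin n → ℕ} (hs : s ∈ divisorVectors r) (j : Fin n) :
    s j ∣ r j :=
  Nat.dvd_of_mem_divisors (Fintype.mem_piFinset.1 hs j)

theorem dvd_ell (s : Fin n → ℕ) (j : Fin n) : s j ∣ ell s := Finset.dvd_lcm (Finset.mem_univ j)

theorem ell_dvd_ell {s : Fin n → ℕ} (hs : s ∈ divisorVectors r) : ell s ∣ ell r :=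
  Finset.lcm_dvd fun j _ => (dvd_of_mem_divisorVectors hs j).trans (dvd_ell r j)

/-- The exponent vector in `∏ ℤ/r_j` attached to `(s, ω)`, scaled by the integer `u`; its `j`-th
entry has additive order `s_j` if `u` is prime to `s_j`. -/
def exponentVector (r : Fin n → ℕ) (u : ℕ) (s ω : Fin n → ℕ) : ∀ j, ZMod (r j) :=
  fun j => ((u * ω j * (r j / s j) : ℕ) : ZMod (r j))

theorem sum_omega_exponentVector {M : Type*} [AddCommMonoid M] [∀ j, NeZero (r j)]
    {s : Fin n → ℕ} (hs : s ∈ divisorVectors r) {u : ℕ} (hu : u.Coprime (ell s))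
    (f : (∀ j, ZMod (r j)) → M) :
    ∑ ω ∈ Omega s, f (exponentVector r u s ω) =
      ∑ e with (fun j => addOrderOf (e j)) = s, f e := by
  have hus (j : Fin n) : u.Coprime (s j) := hu.coprime_dvd_right (dvd_ell s j)
  have himage : (Omega s).image (exponentVector r u s) =
      Finset.univ.filter fun e => (fun j => addOrderOf (e j)) = s := by
    refine (Fintype.piFinset_image (fun j w => ((u * w * (r j / s j) : ℕ) : ZMod (r j)))
      _).symm.trans ?_
    simp only [image_natCast_mul_div (dvd_of_mem_divisorVectors hs _) (hus _)]
    ext e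
    simp [funext_iff]
  rw [← himage, Finset.sum_image]
  intro ω hω ω' hω' h
  funext j
  exact injOn_natCast_mul_div (dvd_of_mem_divisorVectors hs j) (hus j)
    (Finset.mem_filter.1 (Fintype.mem_piFinset.1 hω j)).1
    (Finset.mem_filter.1 (Fintype.mem_piFinset.1 hω' j)).1 (congrFun h j)

theorem sum_exponentVector {M : Type*} [AddCommMonoid M] [∀ j, NeZero (r j)] {u : ℕ → ℕ}
    (hu : ∀ m, m ∣ ell r → (u m).Coprime m) (f : (∀ j, ZMod (r j)) → M) :
    ∑ s ∈ divisorVectors r, ∑ ω ∈ Omega s, f (exponentVector r (u (ell s)) s ω) = ∑ e, f e := by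
  rw [Finset.sum_congr rfl fun s hs => sum_omega_exponentVector hs (hu _ (ell_dvd_ell hs)) f]
  refine Finset.sum_fiberwise_of_maps_to (fun e _ => Fintype.mem_piFinset.2 fun j => ?_) f
  rw [Nat.mem_divisors]
  exact ⟨by simpa using addOrderOf_dvd_card (x := e j), NeZero.ne _⟩

end Reindexing

section CharacterSums

variable {F R : Type*} [Field F] [CommRing R]

theorem mulChar_pow_eq_one {χ : MulChar F R} {N : ℕ} (hχ : orderOf χ ∣ N) (a : Fˣ) :
    χ a ^ N = 1 := by
  rw [← MulChar.pow_apply_coe, orderOf_dvd_iff_pow_eq_one.1 hχ, MulChar.one_apply_coe]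

theorem isPrimitiveRoot_mulChar_generator {g : Fˣ} (hg : ∀ x, x ∈ Subgroup.zpowers g)
    {ψ : MulChar F R} {m : ℕ} (hψ : orderOf ψ = m) : IsPrimitiveRoot (ψ g) m := by
  rw [IsPrimitiveRoot.iff_orderOf, ← hψ, orderOf_eq_orderOf_iff]
  intro i
  rw [MulChar.eq_iff hg, MulChar.pow_apply_coe, MulChar.one_apply_coe]

theorem exists_coprime_mulChar_eq_pow [Finite F] [IsDomain R] {N m : ℕ} [NeZero N] (hm : m ∣ N)
    {ψ χ : MulChar F R} (hψ : orderOf ψ = N) (hχ : orderOf χ = m) :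
    ∃ u : ℕ, u.Coprime m ∧ ∀ a : Fˣ, χ a = ψ a ^ (N / m * u) := by
  obtain ⟨g, hg⟩ := IsCyclic.exists_generator (α := Fˣ)
  have : NeZero m := ⟨ne_zero_of_dvd_ne_zero (NeZero.ne N) hm⟩
  have hprim : IsPrimitiveRoot (ψ g ^ (N / m)) m :=
    (isPrimitiveRoot_mulChar_generator hg hψ).pow (NeZero.pos N) (Nat.div_mul_cancel hm).symm
  obtain ⟨u, -, hu, hχu⟩ := hprim.isPrimitiveRoot_iff.1 (isPrimitiveRoot_mulChar_generator hg hχ)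
  have hpow : χ = ψ ^ (N / m * u) := by
    rw [MulChar.eq_iff hg, MulChar.pow_apply_coe, ← hχu, pow_mul]
  exact ⟨u, hu, fun a => by rw [hpow, MulChar.pow_apply_coe]⟩

theorem mulChar_eq_one_iff_exists_pow_eq [Finite F] {N : ℕ} {ψ : MulChar F R} (hψ : orderOf ψ = N)
    (a : Fˣ) : ψ a = 1 ↔ ∃ w : Fˣ, w ^ N = a := by
  constructor
  · intro h
    obtain ⟨g, hg⟩ := IsCyclic.exists_monoid_generator (α := Fˣ)
    have hprim := isPrimitiveRoot_mulChar_generator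
      (fun x => Submonoid.powers_le_zpowers g (hg x)) hψ
    obtain ⟨i, rfl⟩ := hg a
    obtain ⟨m, rfl⟩ := (hprim.pow_eq_one_iff_dvd i).1 (by simpa using h)
    exact ⟨g ^ m, by rw [← pow_mul, mul_comm]⟩
  · rintro ⟨w, rfl⟩
    rw [Units.val_pow_eq_pow_val, map_pow, mulChar_pow_eq_one hψ.dvd]

theorem sum_addSubgroup_addChar {G : Type*} [AddCommGroup G] [Fintype G] [IsDomain R]
    (H : AddSubgroup G) [DecidablePred (· ∈ H)] (θ : AddChar G R)
    [Decidable (∀ e ∈ H, θ e = 1)] :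
    ∑ e, (if e ∈ H then θ e else 0) = if ∀ e ∈ H, θ e = 1 then (Nat.card H : R) else 0 := by
  classical
  have htriv : θ.compAddMonoidHom H.subtype = 0 ↔ ∀ e ∈ H, θ e = 1 := by
    simp [DFunLike.ext_iff]
  have hsum := AddChar.sum_eq_ite (θ.compAddMonoidHom H.subtype)
  simp only [htriv, ← Nat.card_eq_fintype_card] at hsum
  rw [← Finset.sum_filter, ← hsum]
  exact Finset.sum_subtype _ (by simp) _

section

variable {ι : Type*} [Fintype ι] {r : ι → ℕ} {N : ℕ}

/-- The character `e ↦ ψ (∏ b_j ^ (N / r_j e_j))` of `∏ ℤ/r_j`. -/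
noncomputable def exponentChar (hr : ∀ j, r j ∣ N) {ψ : MulChar F R} (hψ : orderOf ψ ∣ N)
    (b : ι → Fˣ) : AddChar (∀ j, ZMod (r j)) R :=
  (Units.coeHom R).compAddChar <| AddChar.toAddMonoidHomEquiv.symm <|
    zmodPiLift (fun j => Additive.ofMul (ψ.toUnitHom (b j) ^ (N / r j))) fun j => by
      have hone : ψ.toUnitHom (b j) ^ N = 1 := Units.ext (mulChar_pow_eq_one hψ (b j))
      rw [← ofMul_pow, ← pow_mul, Nat.div_mul_cancel (hr j), hone, ofMul_one]

theorem exponentChar_natCast (hr : ∀ j, r j ∣ N) {ψ : MulChar F R} (hψ : orderOf ψ ∣ N)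
    (b : ι → Fˣ) (m : ι → ℕ) : exponentChar hr hψ b (fun j => (m j : ZMod (r j))) =
      ψ ((∏ j, b j ^ (N / r j * m j) : Fˣ) : F) := by
  change ((Additive.toMul (zmodPiLift _ _ _) : Rˣ) : R) = _
  rw [← MulChar.coe_toUnitHom, zmodPiLift_natCast, toMul_sum, map_prod]
  simp only [toMul_nsmul, toMul_ofMul, ← pow_mul, map_pow]

theorem exponentChar_eq_one_iff [Finite F] [∀ j, NeZero (r j)] (hr : ∀ j, r j ∣ N)
    {ψ : MulChar F R} (hψ : orderOf ψ = N) (b : ι → Fˣ) (e : ∀ j, ZMod (r j)) :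
    exponentChar hr hψ.dvd b e = 1 ↔
      ∃ w : Fˣ, w ^ N = ∏ j, b j ^ (N / r j * (e j).val) := by
  rw [← mulChar_eq_one_iff_exists_pow_eq hψ, ← exponentChar_natCast hr hψ.dvd,
    natCast_val_eq]

end

theorem div_mul_div_eq_div {a b c : ℕ} (hb : b ≠ 0) (hba : b ∣ a) (hcb : c ∣ b) :
    a / b * (b / c) = a / c := by
  rw [Nat.div_mul_div_comm hba hcb, mul_comm a b, Nat.mul_div_mul_left _ _ (Nat.pos_of_ne_zero hb)]

theorem div_mul_exponentVector_entry {r s l N u w : ℕ} (hN : N ≠ 0) (hsr : s ∣ r) (hsl : s ∣ l)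
    (hrN : r ∣ N) (hlN : l ∣ N) : N / r * (u * w * (r / s)) = N / l * u * (l / s * w) := by
  have hdiv : N / r * (r / s) = N / l * (l / s) := by
    rw [div_mul_div_eq_div (ne_zero_of_dvd_ne_zero hN hrN) hrN hsr,
      div_mul_div_eq_div (ne_zero_of_dvd_ne_zero hN hlN) hlN hsl]
  calc N / r * (u * w * (r / s)) = N / r * (r / s) * (u * w) := by ring
    _ = N / l * u * (l / s * w) := by rw [hdiv]; ring

variable {n : ℕ} {r : Fin n → ℕ}

theorem orderHom_exponentVector_eq_zero_iff (hr : ell r ≠ 0) {s : Fin n → ℕ}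
    (hs : s ∈ divisorVectors r) {u : ℕ} (hu : u.Coprime (ell s)) (ω : Fin n → ℕ) (k : Fin n → ℤ) :
    orderHom (dvd_ell r) k (exponentVector r u s ω) = 0 ↔
      (ell s : ℤ) ∣ ∑ j, ((ell s / s j * ω j : ℕ) : ℤ) * k j := by
  have hM : ((ell r / ell s : ℕ) : ℤ) ≠ 0 := Int.natCast_ne_zero.2 <|
    left_ne_zero_of_mul ((Nat.div_mul_cancel (ell_dvd_ell hs)).trans_ne hr)
  have hsum : ∑ j, ((ell r / r j * (u * ω j * (r j / s j)) : ℕ) : ℤ) * k j =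
      ((ell r / ell s : ℕ) : ℤ) * (u * ∑ j, ((ell s / s j * ω j : ℕ) : ℤ) * k j) := by
    rw [Finset.mul_sum, Finset.mul_sum]
    refine Finset.sum_congr rfl fun j _ => ?_
    rw [div_mul_exponentVector_entry hr (dvd_of_mem_divisorVectors hs j) (dvd_ell s j) (dvd_ell r j)
      (ell_dvd_ell hs)]
    push_cast
    ring
  have hell : (ell r : ℤ) = ((ell r / ell s : ℕ) : ℤ) * ell s := by
    exact_mod_cast (Nat.div_mul_cancel (ell_dvd_ell hs)).symm
  change orderHom (dvd_ell r) k (fun j => ((u * ω j * (r j / s j) : ℕ) : ZMod (r j))) = 0 ↔ _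
  rw [orderHom_natCast, ZMod.intCast_zmod_eq_zero_iff_dvd, hsum, hell, mul_dvd_mul_iff_left hM]
  exact ⟨(Nat.isCoprime_iff_coprime.2 hu.symm).dvd_of_dvd_mul_left, fun h => h.mul_left _⟩

theorem exponentChar_exponentVector (hr : ell r ≠ 0) {s : Fin n → ℕ} (hs : s ∈ divisorVectors r)
    {u : ℕ} {ψ χ : MulChar F R} (hψ : orderOf ψ ∣ ell r)
    (hχ : ∀ a : Fˣ, χ a = ψ a ^ (ell r / ell s * u)) (b : Fin n → Fˣ) (ω : Fin n → ℕ) :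
    exponentChar (dvd_ell r) hψ b (exponentVector r u s ω) =
      χ ((∏ j, b j ^ (ell s / s j * ω j) : Fˣ) : F) := by
  refine (exponentChar_natCast (dvd_ell r) hψ b fun j => u * ω j * (r j / s j)).trans ?_
  rw [hχ, ← map_pow, ← Units.val_pow_eq_pow_val, ← Finset.prod_pow]
  congr 2
  refine Finset.prod_congr rfl fun j _ => ?_
  rw [← pow_mul, div_mul_exponentVector_entry hr (dvd_of_mem_divisorVectors hs j) (dvd_ell s j)
    (dvd_ell r j) (ell_dvd_ell hs), mul_comm]

open Classical in
theorem sum_mulChar_eq [Finite F] [IsDomain R] (hr : ∀ j, r j ≠ 0) {χ : ℕ → MulChar F R}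
    (hχ : ∀ m, m ∣ ell r → orderOf (χ m) = m) (b : Fin n → Fˣ) (k : Fin n → ℤ) :
    ∑ s ∈ divisorVectors r, ∑ ω ∈ Omega s,
      (if (ell s : ℤ) ∣ ∑ j, ((ell s / s j * ω j : ℕ) : ℤ) * k j then
        χ (ell s) ((∏ j, b j ^ (ell s / s j * ω j) : Fˣ) : F) else 0) =
    ((if HasPowerResidues (dvd_ell r) k b then Nat.card (orderHom (dvd_ell r) k).ker else 0 : ℕ) :
      R) := by
  have hN : ell r ≠ 0 := by simpa [ell, Finset.lcm_eq_zero_iff] using hr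
  have : NeZero (ell r) := ⟨hN⟩
  have (j : Fin n) : NeZero (r j) := ⟨hr j⟩
  have hψ : orderOf (χ (ell r)) = ell r := hχ _ dvd_rfl
  choose! u hu hχu using fun m hm => exists_coprime_mulChar_eq_pow hm hψ (hχ m hm)
  let H := (orderHom (dvd_ell r) k).ker
  let θ := exponentChar (dvd_ell r) hψ.dvd b
  have hterm (s) (hs : s ∈ divisorVectors r) (ω : Fin n → ℕ) :
      (if (ell s : ℤ) ∣ ∑ j, ((ell s / s j * ω j : ℕ) : ℤ) * k j then
        χ (ell s) ((∏ j, b j ^ (ell s / s j * ω j) : Fˣ) : F) else 0) =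
      if exponentVector r (u (ell s)) s ω ∈ H then θ (exponentVector r (u (ell s)) s ω) else 0 :=
    if_congr (orderHom_exponentVector_eq_zero_iff hN hs (hu _ (ell_dvd_ell hs)) ω k).symm
      (exponentChar_exponentVector hN hs hψ.dvd (hχu _ (ell_dvd_ell hs)) b ω).symm rfl
  rw [Finset.sum_congr rfl fun s hs => Finset.sum_congr rfl fun ω _ => hterm s hs ω,
    sum_exponentVector hu fun e => if e ∈ H then θ e else 0, sum_addSubgroup_addChar H θ,
    Nat.cast_ite, Nat.cast_zero]
  exact if_congr (forall₂_congr fun e _ => exponentChar_eq_one_iff _ hψ b e) rfl rfl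

end CharacterSums

section LocalData

theorem mulChar_pow_mod {F R : Type*} [Field F] [CommRing R] {χ : MulChar F R} {m : ℕ}
    (hχ : orderOf χ ∣ m) (a : Fˣ) (i : ℕ) : χ a ^ (i % m) = χ a ^ i :=
  (pow_eq_pow_mod i (mulChar_pow_eq_one hχ a)).symm

theorem mulChar_zero_pow_mul_pow_mod {F R : Type*} [Field F] [CommRing R] {χ : MulChar F R}
    {m ε : ℕ} (hχ : orderOf χ ∣ m) (hε : ε ≤ 1) (a : Fˣ) (i : ℕ) :
    χ (0 ^ ε * a) ^ (i % m) = if m ∣ ε * i then χ a ^ i else 0 := by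
  obtain rfl | rfl := Nat.le_one_iff_eq_zero_or_eq_one.1 hε
  · simp [mulChar_pow_mod hχ]
  · rw [← mulChar_pow_mod hχ a i, pow_one, zero_mul, MulChar.map_zero, one_mul]
    split_ifs with h
    · rw [Nat.mod_eq_zero_of_dvd h, pow_zero, pow_zero]
    · exact zero_pow fun h0 => h (Nat.dvd_of_mod_eq_zero h0)

theorem dvd_sum_mul_iff {ι R : Type*} [Fintype ι] [CommSemiring R] {ε : ι → R}
    (hε : (Function.support ε).Subsingleton) (l : R) (m : ι → R) :
    l ∣ ∑ α, ε α * m α ↔ ∀ α, l ∣ ε α * m α := by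
  refine ⟨fun h α => ?_, fun h => Finset.dvd_sum fun α _ => h α⟩
  by_cases hα : ε α = 0
  · rw [hα, zero_mul]
    exact dvd_zero l
  · rwa [Fintype.sum_eq_single α fun β hβ => by
      rw [Function.notMem_support.1 fun h0 => hβ (hε h0 hα), zero_mul]] at h

theorem prod_mul_prod_pow_pow {ι κ M : Type*} [Fintype ι] [Fintype κ] [CommMonoid M] (c : ι → M)
    (h : κ → M) (w : ι → ℕ) (a : κ → ι → ℕ) :
    ∏ j, (c j * ∏ α, h α ^ a α j) ^ w j = (∏ j, c j ^ w j) * ∏ α, h α ^ ∑ j, w j * a α j := by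
  simp only [mul_pow, Finset.prod_mul_distrib, ← Finset.prod_pow, ← pow_mul,
    ← Finset.prod_pow_eq_pow_sum, mul_comm (w _)]
  rw [Finset.prod_comm]

variable {F : Type*} [Field F]

theorem rootMultiplicity_le_one_of_squarefree {p : F[X]} (hp : Squarefree p) (x : F) :
    p.rootMultiplicity x ≤ 1 := by
  by_contra! h
  have hdvd : (X - C x) ^ 2 ∣ p := (le_rootMultiplicity_iff hp.ne_zero).1 h
  exact not_isUnit_X_sub_C x (hp _ (by rwa [← pow_two]))

theorem eval_eq_zero_pow_rootMultiplicity_mul (p : F[X]) (x : F) :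
    p.eval x =
      0 ^ p.rootMultiplicity x * (p /ₘ (X - C x) ^ p.rootMultiplicity x).eval x := by
  conv_lhs => rw [← pow_mul_divByMonic_rootMultiplicity_eq p x]
  simp

variable {n : ℕ} {r : Fin n → ℕ} {f : IndexSet r → F[X]}

theorem IsAdmissibleTuple.support_rootMultiplicity_subsingleton (hf : IsAdmissibleTuple f) (x : F) :
    (Function.support fun α => (f α).rootMultiplicity x).Subsingleton := by
  intro α hα β hβ
  by_contra hne
  have hdvd (γ) (hγ : (f γ).rootMultiplicity x ≠ 0) : X - C x ∣ f γ :=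
    dvd_iff_isRoot.2 (rootMultiplicity_pos'.1 (Nat.pos_of_ne_zero hγ)).2
  exact not_isUnit_X_sub_C x ((hf.2 α β hne).isUnit_of_dvd' (hdvd α hα) (hdvd β hβ))

theorem mulChar_leadCoeff {R : Type*} [CommRing R] {s : Fin n → ℕ} {χ : MulChar F R}
    (hχ : orderOf χ ∣ ell s) (c : Fin n → Fˣ) (ω : Fin n → ℕ) :
    χ (leadCoeff c s ω) = χ ((∏ j, c j ^ (ell s / s j * ω j) : Fˣ) : F) := by
  simp only [leadCoeff, Units.coe_prod, Units.val_pow_eq_pow_val, map_prod, map_pow,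
    mulChar_pow_mod hχ]

theorem kummerPoly_eq_pow_mul (c : Fin n → Fˣ) {h : IndexSet r → F[X]} {ε : IndexSet r → ℕ}
    {p : F[X]} (hfh : ∀ α, p ^ ε α * h α = f α) (j : Fin n) :
    kummerPoly c f j = p ^ (∑ α, ε α * (α.1 j : ℕ)) * kummerPoly c h j := by
  simp only [kummerPoly, ← hfh, mul_pow, Finset.prod_mul_distrib, ← pow_mul,
    Finset.prod_pow_eq_pow_sum]
  ring

/-- The data at the point `x` of the line on which the local count of points depends: the Kummer
generators are `F_j = t ^ k_j * g_j(t)` for the uniformizer `t` at `x`, with residues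
`b_j = g_j(0) ≠ 0`, and `k`, `b` determine the values of characters at `F_(s)^(ω)(x)`. -/
structure IsLocalData (R : Type*) [CommRing R] (c : Fin n → Fˣ) (f : IndexSet r → F[X])
    (x : OnePoint F) (k : Fin n → ℤ) (g : Fin n → F[X]) (b : Fin n → Fˣ) : Prop where
  eval_zero : ∀ j, (g j).eval 0 = b j
  kummerPoly_eq : ∀ j, algebraMap F[X] (RatFunc F) (kummerPoly c f j) =
    uniformizer x ^ k j * aeval (uniformizer x) (g j)
  mulChar_twistedValue : ∀ (s ω : Fin n → ℕ) (χ : MulChar F R), orderOf χ ∣ ell s →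
    χ (twistedValue c f s ω x) =
      if (ell s : ℤ) ∣ ∑ j, ((ell s / s j * ω j : ℕ) : ℤ) * k j then
        χ ((∏ j, b j ^ (ell s / s j * ω j) : Fˣ) : F) else 0

theorem leadingCoeff_kummerPoly (c : Fin n → Fˣ) (hf : ∀ α, (f α).Monic) (j : Fin n) :
    (kummerPoly c f j).leadingCoeff = c j := by
  have hmonic : (∏ α : IndexSet r, f α ^ (α.1 j : ℕ)).Monic :=
    monic_prod_of_monic _ _ fun α _ => (hf α).pow _
  rw [kummerPoly, leadingCoeff_mul, leadingCoeff_C, hmonic.leadingCoeff, mul_one]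

theorem isLocalData_infty (R : Type*) [CommRing R] (c : Fin n → Fˣ) (hf : ∀ α, (f α).Monic) :
    IsLocalData R c f OnePoint.infty (fun j => -((kummerPoly c f j).natDegree : ℤ))
      (fun j => (kummerPoly c f j).reverse) c where
  eval_zero j := by
    rw [← coeff_zero_eq_eval_zero, coeff_zero_reverse, leadingCoeff_kummerPoly c hf]
  kummerPoly_eq j := algebraMap_eq_uniformizer_infty_zpow_mul _
  mulChar_twistedValue s ω χ hχ := by
    have hdvd : (ell s : ℤ) ∣ ∑ j, ((ell s / s j * ω j : ℕ) : ℤ) *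
        (-((kummerPoly c f j).natDegree : ℤ)) ↔
        ell s ∣ ∑ j, ell s / s j * ω j * (kummerPoly c f j).natDegree := by
      simp only [mul_neg, Finset.sum_neg_distrib, dvd_neg]
      exact_mod_cast Int.natCast_dvd_natCast
    simp only [twistedValue, hdvd, apply_ite χ, mulChar_leadCoeff hχ, MulChar.map_zero]

theorem IsAdmissibleTuple.mulChar_eval_twistedPoly {R : Type*} [CommRing R] (c : Fin n → Fˣ)
    (hf : IsAdmissibleTuple f) {s ω : Fin n → ℕ} {χ : MulChar F R} (hχ : orderOf χ ∣ ell s) {x : F}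
    {h : IndexSet r → Fˣ}
    (hfh : ∀ α, (f α).eval x = 0 ^ (f α).rootMultiplicity x * (h α : F)) :
    χ ((twistedPoly c f s ω).eval x) =
      if ell s ∣ ∑ j, ell s / s j * ω j * ∑ α, (f α).rootMultiplicity x * (α.1 j : ℕ) then
        χ ((∏ j, (c j * ∏ α, h α ^ (α.1 j : ℕ)) ^ (ell s / s j * ω j) : Fˣ) : F) else 0 := by
  have hsum : ∑ j, ell s / s j * ω j * ∑ α, (f α).rootMultiplicity x * (α.1 j : ℕ) =
      ∑ α, (f α).rootMultiplicity x * ∑ j, ell s / s j * ω j * (α.1 j : ℕ) := by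
    simp only [Finset.mul_sum]
    rw [Finset.sum_comm]
    exact Finset.sum_congr rfl fun α _ => Finset.sum_congr rfl fun j _ => by ring
  have hfactor (α : IndexSet r) (m : ℕ) : χ ((f α).eval x) ^ (m % ell s) =
      if ell s ∣ (f α).rootMultiplicity x * m then χ (h α) ^ m else 0 := by
    rw [hfh, mulChar_zero_pow_mul_pow_mod hχ (rootMultiplicity_le_one_of_squarefree (hf.1 α).2 x)]
  simp only [twistedPoly, eval_mul, eval_C, eval_prod, eval_pow, map_mul, map_prod, map_pow,
    hfactor, mulChar_leadCoeff hχ, Fintype.prod_ite_zero, mul_ite, mul_zero, hsum,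
    dvd_sum_mul_iff (hf.support_rootMultiplicity_subsingleton x)]
  refine if_congr Iff.rfl ?_ rfl
  simp only [prod_mul_prod_pow_pow, Units.val_mul, Units.coe_prod, Units.val_pow_eq_pow_val,
    map_mul, map_prod, map_pow]

theorem IsAdmissibleTuple.exists_isLocalData_coe (R : Type*) [CommRing R] (c : Fin n → Fˣ)
    (hf : IsAdmissibleTuple f) (x : F) : ∃ k g b, IsLocalData R c f (OnePoint.some x) k g b := by
  let ε (α : IndexSet r) := (f α).rootMultiplicity x
  let h (α : IndexSet r) := f α /ₘ (X - C x) ^ ε α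
  let b (α : IndexSet r) : Fˣ :=
    Units.mk0 _ (eval_divByMonic_pow_rootMultiplicity_ne_zero x (hf.1 α).1.ne_zero)
  refine ⟨fun j => ((∑ α, ε α * (α.1 j : ℕ) : ℕ) : ℤ), fun j => (kummerPoly c h j).comp (X + C x),
    fun j => c j * ∏ α, b α ^ (α.1 j : ℕ), fun j => ?_, fun j => ?_, fun s ω χ hχ => ?_⟩
  · simp [kummerPoly, eval_comp, eval_prod, h, b, ε]
  · have hshift : ((kummerPoly c h j).comp (X + C x)).comp (X - C x) = kummerPoly c h j := by
      simp [comp_assoc]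
    rw [aeval_uniformizer_coe, hshift, zpow_natCast, kummerPoly_eq_pow_mul c
      fun α => pow_mul_divByMonic_rootMultiplicity_eq (f α) x, map_mul, map_pow]
    rfl
  · refine (hf.mulChar_eval_twistedPoly c hχ (h := b)
      fun α => eval_eq_zero_pow_rootMultiplicity_mul (f α) x).trans (if_congr ?_ rfl rfl)
    rw [← Int.natCast_dvd_natCast]
    push_cast
    rfl

theorem IsAdmissibleTuple.exists_isLocalData (R : Type*) [CommRing R] (c : Fin n → Fˣ)
    (hf : IsAdmissibleTuple f) (x : OnePoint F) : ∃ k g b, IsLocalData R c f x k g b := by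
  induction x using OnePoint.rec with
  | infty => exact ⟨_, _, _, isLocalData_infty R c fun α => (hf.1 α).1⟩
  | coe x => exact hf.exists_isLocalData_coe R c x

theorem isAdmissibleTuple_of_mem_tuplesBracket {d : IndexSet r → ℕ}
    (hf : f ∈ tuplesBracket F d) : IsAdmissibleTuple f := by
  rcases hf with hf | hf
  · exact hf.1
  · obtain ⟨β, hβ⟩ := Set.mem_iUnion.1 hf
    exact hβ.1

variable {c : Fin n → Fˣ} {L : Type*} [Field L] [Algebra (RatFunc F) L]

theorem CorrespondsTo.finiteDimensional (hr : ∀ j, r j ≠ 0) (hL : CorrespondsTo L c f) :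
    FiniteDimensional (RatFunc F) L := by
  obtain ⟨hgal, ⟨e⟩, -⟩ := hL
  have (j : Fin n) : NeZero (r j) := ⟨hr j⟩
  have : Finite (L ≃ₐ[RatFunc F] L) := .of_equiv _ (e.toEquiv.trans Multiplicative.toAdd).symm
  exact IsGalois.finiteDimensional_of_finite _ _

theorem CorrespondsTo.exists_isFullKummer [FiniteDimensional (RatFunc F) L]
    (hL : CorrespondsTo L c f) :
    ∃ y : Fin n → L, IsFullKummer (RatFunc F) r y ∧ ∀ j, y j ^ r j =
      algebraMap (RatFunc F) L (algebraMap F[X] (RatFunc F) (kummerPoly c f j)) := by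
  obtain ⟨hgal, ⟨e⟩, y, hy, hgen⟩ := hL
  have hcard : Nat.card (L ≃ₐ[RatFunc F] L) = ∏ j, r j := by
    rw [Nat.card_congr (e.toEquiv.trans Multiplicative.toAdd), Nat.card_pi]
    simp only [Nat.card_zmod]
  exact ⟨y, ⟨fun j => ⟨_, (hy j).symm⟩, hgen, by rw [← IsGalois.card_aut_eq_finrank, hcard]⟩, hy⟩

end LocalData

theorem hasEnoughRootsOfUnity_of_dvd_card_sub_one {F : Type*} [Field F] [Fintype F] {N : ℕ}
    (hN : N ∣ Fintype.card F - 1) : HasEnoughRootsOfUnity F N := by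
  classical
  have : NeZero (Fintype.card F - 1) := ⟨(Nat.sub_pos_of_lt Fintype.one_lt_card).ne'⟩
  have htop : rootsOfUnity (Fintype.card F - 1) F = ⊤ :=
    eq_top_iff.2 fun x _ => by rw [mem_rootsOfUnity, ← Fintype.card_units, pow_card_eq_one]
  have : HasEnoughRootsOfUnity F (Fintype.card F - 1) := .of_card_le <| by
    rw [htop, Subgroup.card_top, Nat.card_eq_fintype_card, Fintype.card_units]
  exact .of_dvd F hN

end AbelianCover

theorem lemma3p2_general {F : Type*} [Field F] [Fintype F] {n : ℕ} (r : Fin n → ℕ)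
    (hq : ∀ j, Fintype.card F ≡ 1 [MOD r j]) (c : Fin n → Fˣ)
    (f : AbelianCover.IndexSet r → Polynomial F) (hf : AbelianCover.IsAdmissibleTuple f)
    {L : Type*} [Field L] [Algebra (RatFunc F) L] [Algebra F L] [IsScalarTower F (RatFunc F) L]
    (hL : AbelianCover.CorrespondsTo L c f) {R : Type*} [CommRing R] [IsDomain R]
    (χ : ℕ → MulChar F R) (hχ : ∀ m, m ∣ Finset.univ.lcm r → orderOf (χ m) = m) :
    (AbelianCover.rationalPoints F L).Finite ∧
    ((AbelianCover.rationalPoints F L).ncard : R) =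
      ∑ x : OnePoint F, ∑ s ∈ AbelianCover.divisorVectors r, ∑ ω ∈ AbelianCover.Omega s,
        χ (AbelianCover.ell s) (AbelianCover.twistedValue c f s ω x) := by
  have hdvd : AbelianCover.ell r ∣ Fintype.card F - 1 :=
    Finset.lcm_dvd fun j _ => (Nat.modEq_iff_dvd' Fintype.card_pos).1 (hq j).symm
  have hN : NeZero (AbelianCover.ell r) :=
    ⟨ne_zero_of_dvd_ne_zero (Nat.sub_pos_of_lt Fintype.one_lt_card).ne' hdvd⟩
  have hr (j : Fin n) : r j ≠ 0 := ne_zero_of_dvd_ne_zero hN.out (AbelianCover.dvd_ell r j)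
  have := AbelianCover.hasEnoughRootsOfUnity_of_dvd_card_sub_one hdvd
  have := hL.isGalois
  have := hL.finiteDimensional hr
  obtain ⟨y, hy, hroot⟩ := hL.exists_isFullKummer
  choose k g b hdata using hf.exists_isLocalData R c
  have hlocal (x : OnePoint F) := hy.finite_rationalZeros_and_ncard_eq (AbelianCover.dvd_ell r)
    (AbelianCover.transcendental_uniformizer x) (AbelianCover.exists_eq_aeval_uniformizer_div x)
    (hdata x).eval_zero (fun j => by rw [hroot, (hdata x).kummerPoly_eq])
  obtain ⟨hfin, hncard⟩ := AbelianCover.ncard_rationalPoints_eq_sum fun x => (hlocal x).1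
  refine ⟨hfin, ?_⟩
  rw [hncard, Nat.cast_sum]
  refine Finset.sum_congr rfl fun x _ => ?_
  rw [(hlocal x).2, ← AbelianCover.sum_mulChar_eq hr hχ]
  refine Finset.sum_congr rfl fun s hs => Finset.sum_congr rfl fun ω _ => ?_
  exact ((hdata x).mulChar_twistedValue s ω _ (hχ _ (AbelianCover.ell_dvd_ell hs)).dvd).symm

theorem lemma3p2
    -- the finite field with `q` elements
    {F : Type*} [Field F] [Fintype F]
    -- `G = ℤ/r_1 × ⋯ × ℤ/r_n` with `r_j ∣ r_{j+1}` and `q ≡ 1 mod exp(G)`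
    {n : ℕ} (r : Fin n → ℕ) (hr_pos : ∀ j, 0 < r j) (hr_dvd : ∀ i j, i ≤ j → r i ∣ r j)
    (hq : ∀ j, Fintype.card F ≡ 1 [MOD r j])
    -- the degree vector, with `d_j = ∑_α α_j d(α) ≡ 0 mod r_j`
    (d : AbelianCover.IndexSet r → ℕ) (hd : ∀ j, ∑ α, (α.1 j : ℕ) * d α ≡ 0 [MOD r j])
    -- the data `(c, (f_α))`
    (c : Fin n → Fˣ) (f : AbelianCover.IndexSet r → Polynomial F)
    (hf : f ∈ AbelianCover.tuplesBracket F d)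
    -- the function field `L = K(C)` of the curve `C` that corresponds to `(c, (f_α))`
    {L : Type*} [Field L] [Algebra (RatFunc F) L] [Algebra F L] [IsScalarTower F (RatFunc F) L]
    (hL : AbelianCover.CorrespondsTo L c f)
    -- for each relevant `m`, a multiplicative character of order `m` (with value `0` at `0`)
    (χ : ℕ → MulChar F ℂ) (hχ : ∀ m, m ∣ Finset.univ.lcm r → orderOf (χ m) = m) :
    (AbelianCover.rationalPoints F L).Finite ∧
    ((AbelianCover.rationalPoints F L).ncard : ℂ) =
      ∑ x : OnePoint F, ∑ s ∈ AbelianCover.divisorVectors r, ∑ ω ∈ AbelianCover.Omega s,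
        χ (AbelianCover.ell s) (AbelianCover.twistedValue c f s ω x) := by
  exact lemma3p2_general r hq c f (AbelianCover.isAdmissibleTuple_of_mem_tuplesBracket hf) hL χ hχ
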